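/- Let $X$ be a complex manifold of dimension $n\ge 1$ and let $\mathcal F$ be a smooth foliation of $X$ of real dimension $1$. A chart for $\mathcal F$ is a diffeomorphism from an open subset $U$ of $X$ onto an open subset $V$ of $\mathbb C^n$ that takes $\mathcal F|U$ to the foliation of $V$ by the straight lines along which $\operatorname{Im} z_1$ and $z_2,\dots,z_n$ are constant. We say that $\mathcal F$ has a holomorphic atlas if $X$ is covered by the domains of charts for $\mathcal F$ that are biholomorphic onto their images. We say that $\mathcal F$ is quasiholomorphic if (1) $\mathcal F$ has no compact leaves; and, for all $p,q\in X$ in the same leaf, there are an open neighbourhood $U$ of $p$ in $X$ and a biholomorphism $h$ from $U$ onto an open neighbourhood of $q$ such that (2) $h(p)=q$ and $h(x)$ lies in the leaf of $x$ for all $x\in U$; and (3) if $a\in U$ and $b$ is a point in the leaf of $a$ between $a$ and $h(a)$, then there is a biholomorphism $k$ from $U$ onto an open neighbourhood of $b$ such that $k(a)=b$ and $k(x)$ lies in the leaf of $x$ between $x$ and $h(x)$ for every $x\in U$. Here a point of a noncompact leaf, which is an injectively immersed line, is between two points of the leaf if it belongs to the closed segment of the leaf with these endpoints. **Theorem.**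 (a) $\mathcal F$ has a holomorphic atlas if and only if each point of $X$ has an open neighbourhood on which $\mathcal F$ is induced by a nowhere-vanishing holomorphic vector field (that is, the field, viewed as a real vector field, is tangent to $\mathcal F$). (b) If $\mathcal F$ has no compact leaves and has a holomorphic atlas (equivalently, by (a), is locally induced by nowhere-vanishing holomorphic vector fields), then $\mathcal F$ is quasiholomorphic. -/

import Mathlib

open Set
open scoped Manifold ContDiff Topology

/-- The real line of directions in `ℂⁿ` along which `Im z₁` and `z₂, …, zₙ` are constant
(coordinates are indexed from `0`).  Its translates are the leaves of the standard foliation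
of `ℂⁿ`. -/
def horizontalLine (n : ℕ) [NeZero n] : Submodule ℝ (EuclideanSpace ℂ (Fin n)) where
  carrier := {u | (u 0).im = 0 ∧ ∀ j : Fin n, j ≠ 0 → u j = 0}
  add_mem' := by
    rintro u v ⟨hu, hu'⟩ ⟨hv, hv'⟩
    exact ⟨by simp [hu, hv], fun j hj => by simp [hu' j hj, hv' j hj]⟩
  zero_mem' := by simp
  smul_mem' := by
    rintro c u ⟨hu, hu'⟩
    exact ⟨by simp [hu], fun j hj => by simp [hu' j hj]⟩

section Maps

variable (n : ℕ) {M N : Type*}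
  [TopologicalSpace M] [ChartedSpace (EuclideanSpace ℂ (Fin n)) M]
  [TopologicalSpace N] [ChartedSpace (EuclideanSpace ℂ (Fin n)) N]

/-- A homeomorphism between open subsets of two complex manifolds is a diffeomorphism: it and
its inverse are smooth in the real sense. -/
def IsRealDiffeo (f : OpenPartialHomeomorph M N) : Prop :=
  ContMDiffOn 𝓘(ℝ, EuclideanSpace ℂ (Fin n)) 𝓘(ℝ, EuclideanSpace ℂ (Fin n)) ∞ f f.source ∧
  ContMDiffOn 𝓘(ℝ, EuclideanSpace ℂ (Fin n)) 𝓘(ℝ, EuclideanSpace ℂ (Fin n)) ∞ f.symm f.target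

/-- A homeomorphism between open subsets of two complex manifolds is a biholomorphism: it and
its inverse are complex analytic. -/
def IsBiholo (f : OpenPartialHomeomorph M N) : Prop :=
  ContMDiffOn 𝓘(ℂ, EuclideanSpace ℂ (Fin n)) 𝓘(ℂ, EuclideanSpace ℂ (Fin n)) ω f f.source ∧
  ContMDiffOn 𝓘(ℂ, EuclideanSpace ℂ (Fin n)) 𝓘(ℂ, EuclideanSpace ℂ (Fin n)) ω f.symm f.target

end Maps

/-- Two charts with values in `ℂⁿ` induce the same foliation on the overlap of their domains:
locally, two points lie on the same horizontal line in one chart if and only if they do so in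
the other. -/
def FoliationCompatible {n : ℕ} [NeZero n] {X : Type*} [TopologicalSpace X]
    (e e' : OpenPartialHomeomorph X (EuclideanSpace ℂ (Fin n))) : Prop :=
  ∀ p ∈ e.source ∩ e'.source, ∃ O ∈ 𝓝 p, O ⊆ e.source ∩ e'.source ∧
    ∀ x ∈ O, ∀ y ∈ O, e x - e y ∈ horizontalLine n ↔ e' x - e' y ∈ horizontalLine n

/-- A smooth foliation of real dimension one of an `n`-dimensional complex manifold, given by
its maximal atlas, that is, by the set of all its charts: diffeomorphisms from open subsets of
`X` onto open subsets of `ℂⁿ` that take the foliation to the foliation by horizontal lines. -/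
structure SmoothFoliation (n : ℕ) [NeZero n] (X : Type*) [TopologicalSpace X]
    [ChartedSpace (EuclideanSpace ℂ (Fin n)) X] where
  /-- The charts for the foliation. -/
  charts : Set (OpenPartialHomeomorph X (EuclideanSpace ℂ (Fin n)))
  diffeo : ∀ e ∈ charts, IsRealDiffeo n e
  cover : ∀ x : X, ∃ e ∈ charts, x ∈ e.source
  compatible : ∀ e ∈ charts, ∀ e' ∈ charts, FoliationCompatible e e'
  maximal : ∀ e, IsRealDiffeo n e → (∀ e' ∈ charts, FoliationCompatible e e') → e ∈ charts

namespace SmoothFoliation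

variable {n : ℕ} [NeZero n] {X : Type*} [TopologicalSpace X]
  [ChartedSpace (EuclideanSpace ℂ (Fin n)) X]

/-- The leaf topology on `X`, generated by the plaques, that is, by the intersections of open
subsets of `X` with the preimages of horizontal lines under charts. -/
@[reducible] def leafTopology (F : SmoothFoliation n X) : TopologicalSpace X :=
  TopologicalSpace.generateFrom
    {A | ∃ e ∈ F.charts, ∃ z : EuclideanSpace ℂ (Fin n), ∃ O : Set X, IsOpen O ∧
      A = {x | x ∈ O ∧ x ∈ e.source ∧ e x - z ∈ horizontalLine n}}

/-- The leaf through `p`: its connected component in the leaf topology. -/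
def leaf (F : SmoothFoliation n X) (p : X) : Set X :=
  @connectedComponent X F.leafTopology p

/-- No leaf is compact (as a one-dimensional manifold, that is, in the leaf topology). -/
def HasNoCompactLeaves (F : SmoothFoliation n X) : Prop :=
  ∀ p : X, ¬ @IsCompact X F.leafTopology (F.leaf p)

/-- `a` and `c` lie in the same leaf, and `b` lies in that leaf between `a` and `c` (endpoints
included): `b` belongs to every connected subset of the leaf, in the leaf topology, that
contains `a` and `c`.  For a noncompact leaf, which is a line, this says that `b` belongs to the
closed interval with endpoints `a` and `c`. -/
def Between (F : SmoothFoliation n X) (a b c : X) : Prop :=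
  c ∈ F.leaf a ∧
    ∀ S : Set X, S ⊆ F.leaf a → @IsConnected X F.leafTopology S → a ∈ S → c ∈ S → b ∈ S

/-- The foliation has an atlas, that is, a set of charts whose domains cover `X`, consisting of
holomorphic charts. -/
def HasHolomorphicAtlas (F : SmoothFoliation n X) : Prop :=
  ∃ A : Set (OpenPartialHomeomorph X (EuclideanSpace ℂ (Fin n))), A ⊆ F.charts ∧
    (∀ e ∈ A, IsBiholo n e) ∧ ∀ x : X, ∃ e ∈ A, x ∈ e.source

/-- A vector in the complex tangent space as a vector in the real tangent space.  In Mathlib,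
both are the model space `ℂⁿ`, through the preferred chart at `x`. -/
def realTangent {x : X} (v : TangentSpace 𝓘(ℂ, EuclideanSpace ℂ (Fin n)) x) :
    TangentSpace 𝓘(ℝ, EuclideanSpace ℂ (Fin n)) x := v

/-- On `W`, the foliation is induced by the nowhere-vanishing vector field `v`: at each point of
`W`, `v` is nonzero and is tangent to the foliation, that is, its image under the (real)
differential of any chart is horizontal. -/
def IsInducedOn (F : SmoothFoliation n X)
    (v : ∀ x : X, TangentSpace 𝓘(ℂ, EuclideanSpace ℂ (Fin n)) x) (W : Set X) : Prop :=
  ∀ x ∈ W, v x ≠ 0 ∧ ∀ e ∈ F.charts, x ∈ e.source →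
    mfderiv 𝓘(ℝ, EuclideanSpace ℂ (Fin n)) 𝓘(ℝ, EuclideanSpace ℂ (Fin n)) e x
      (realTangent (v x)) ∈ horizontalLine n

/-- Each point of `X` has an open neighbourhood on which the foliation is induced by a
nowhere-vanishing holomorphic vector field. -/
def IsLocallyInducedByHolomorphicFields [IsManifold 𝓘(ℂ, EuclideanSpace ℂ (Fin n)) ω X]
    (F : SmoothFoliation n X) : Prop :=
  ∀ p : X, ∃ W : Set X, IsOpen W ∧ p ∈ W ∧
    ∃ v : ∀ x : X, TangentSpace 𝓘(ℂ, EuclideanSpace ℂ (Fin n)) x,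
      ContMDiffOn 𝓘(ℂ, EuclideanSpace ℂ (Fin n)) 𝓘(ℂ, EuclideanSpace ℂ (Fin n)).tangent ω
        (fun x => (⟨x, v x⟩ : TangentBundle 𝓘(ℂ, EuclideanSpace ℂ (Fin n)) X)) W ∧
      F.IsInducedOn v W

/-- The foliation is quasiholomorphic.  The open set `U` is the domain `h.source`. -/
structure IsQuasiholomorphic (F : SmoothFoliation n X) : Prop where
  noCompactLeaves : F.HasNoCompactLeaves
  exists_biholo : ∀ p q : X, q ∈ F.leaf p →
    ∃ h : OpenPartialHomeomorph X X, IsBiholo n h ∧ p ∈ h.source ∧ h p = q ∧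
      (∀ x ∈ h.source, h x ∈ F.leaf x) ∧
      ∀ a ∈ h.source, ∀ b : X, F.Between a b (h a) →
        ∃ k : OpenPartialHomeomorph X X, IsBiholo n k ∧ k.source = h.source ∧ k a = b ∧
          ∀ x ∈ k.source, F.Between x (k x) (h x)

end SmoothFoliation

/-! Everything rests on a rigidity of holomorphic charts. If the transition g between two of them
preserves horizontal lines, then ∂g/∂z₁ is a holomorphic multiple of the first basis vector with a
real-valued factor, and a real-valued holomorphic function is locally constant. So horizontal unit
translation in one chart is, near a common point, horizontal unit translation in a real rescaling of
the other, on all nearby leaves at once (`exists_horizontal_factor`, `exists_rescale_sameFlow`).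

For (b), unit translation in a chart at p therefore continues along the leaves. Its orbits are the
maximal affine curves, and each of them sweeps out its whole leaf (`IsMaximalAffine.image_eq_leaf`).
In a noncompact leaf such a curve is injective (`IsAffineOn.injOn`), so betweenness of points
becomes order of times (`IsAffineOn.between`). Pick a curve from p that reaches q at time t ≥ 0.
Near p the motion for time s in [0, t] is a composition of translations in holomorphic charts, hence
biholomorphic (`flowsTo_of_mem`). Time t gives h; a point between a and h(a) is reached from a at
some time s, and time s gives k.

For (a), a holomorphic atlas yields fields by pulling back the constant field ∂/∂z₁. Conversely a
nowhere-vanishing holomorphic field is straightened by its flow in complex time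
(`AnalyticAt.exists_flowBox`). Analyticity of the flow in time and initial point comes from the
inverse function theorem in the Banach space of continuous paths
(`exists_analyticAt_integral_equation`). The differentials of the transitions between a
straightening chart and any chart for the foliation preserve the horizontal direction both ways, so
maximality of the atlas makes the straightening chart one of its charts
(`mem_charts_of_isInducedOn`). -/

open Filter

/-! ### Linear algebra and calculus of the horizontal line -/

/-- The unit vector spanning the horizontal line. -/
noncomputable def horizontalUnit (n : ℕ) [NeZero n] : EuclideanSpace ℂ (Fin n) :=
  EuclideanSpace.single 0 1

/-- The projection of `ℂⁿ` along the horizontal line that forgets `Re z₁`. -/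
noncomputable def transverseProj (n : ℕ) [NeZero n] :
    EuclideanSpace ℂ (Fin n) →L[ℝ] EuclideanSpace ℂ (Fin n) :=
  ContinuousLinearMap.id ℝ _ -
    (Complex.reCLM.comp
      ((EuclideanSpace.proj (𝕜 := ℂ) (0 : Fin n)).restrictScalars ℝ)).smulRight (horizontalUnit n)

section Line

variable {n : ℕ} [NeZero n]

theorem horizontalUnit_ne_zero : horizontalUnit n ≠ 0 := by
  intro h
  have := congrArg (fun u : EuclideanSpace ℂ (Fin n) => u 0) h
  simp [horizontalUnit] at this

theorem norm_horizontalUnit : ‖horizontalUnit n‖ = 1 := by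
  simp [horizontalUnit]

@[simp] theorem horizontalUnit_apply_zero : horizontalUnit n 0 = 1 := by
  simp [horizontalUnit]

theorem mem_horizontalLine_iff {u : EuclideanSpace ℂ (Fin n)} :
    u ∈ horizontalLine n ↔ u = (u 0).re • horizontalUnit n := by
  change ((u 0).im = 0 ∧ ∀ j : Fin n, j ≠ 0 → u j = 0) ↔ _
  constructor
  · rintro ⟨h0, hj⟩
    ext j
    by_cases hj0 : j = 0
    · subst hj0
      simp [Complex.ext_iff, h0]
    · simp [hj j hj0, horizontalUnit, hj0]
  · intro h
    rw [h]
    refine ⟨by simp, fun j hj => by simp [horizontalUnit, hj]⟩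

theorem smul_horizontalUnit_mem (s : ℝ) : s • horizontalUnit n ∈ horizontalLine n := by
  rw [mem_horizontalLine_iff]; simp

theorem mem_horizontalLine_iff_exists {u : EuclideanSpace ℂ (Fin n)} :
    u ∈ horizontalLine n ↔ ∃ s : ℝ, u = s • horizontalUnit n :=
  ⟨fun h => ⟨_, mem_horizontalLine_iff.1 h⟩, by
    rintro ⟨s, rfl⟩; exact smul_horizontalUnit_mem s⟩

theorem transverseProj_apply (u : EuclideanSpace ℂ (Fin n)) :
    transverseProj n u = u - (u 0).re • horizontalUnit n := by
  simp [transverseProj]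

theorem mem_horizontalLine_iff_transverseProj {u : EuclideanSpace ℂ (Fin n)} :
    u ∈ horizontalLine n ↔ transverseProj n u = 0 := by
  rw [mem_horizontalLine_iff, transverseProj_apply, sub_eq_zero]

theorem smul_horizontalUnit_injective :
    Function.Injective fun s : ℝ => s • horizontalUnit n := fun _ _ h =>
  smul_left_injective ℝ horizontalUnit_ne_zero h

/-- A curve that stays in a horizontal line has horizontal derivative. -/
theorem HasDerivAt.mem_horizontalLine {f : ℝ → EuclideanSpace ℂ (Fin n)}
    {f' : EuclideanSpace ℂ (Fin n)} {t : ℝ} (hf : HasDerivAt f f' t)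
    (h : ∀ᶠ s in 𝓝 t, f s - f t ∈ horizontalLine n) : f' ∈ horizontalLine n := by
  rw [mem_horizontalLine_iff_transverseProj]
  have h1 : HasDerivAt (fun s => transverseProj n (f s)) (transverseProj n f') t :=
    (transverseProj n).hasFDerivAt.comp_hasDerivAt t hf
  have h2 : (fun s => transverseProj n (f s)) =ᶠ[𝓝 t] fun _ => transverseProj n (f t) := by
    filter_upwards [h] with s hs
    rw [mem_horizontalLine_iff_transverseProj, map_sub, sub_eq_zero] at hs
    exact hs
  exact (h1.congr_of_eventuallyEq h2.symm).unique (hasDerivAt_const t _)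

/-- A map of a convex set whose derivative preserves the horizontal line takes horizontal
segments into horizontal lines. -/
theorem sub_mem_horizontalLine_of_fderiv {B : Set (EuclideanSpace ℂ (Fin n))} (hB : Convex ℝ B)
    {g : EuclideanSpace ℂ (Fin n) → EuclideanSpace ℂ (Fin n)}
    (hg : ∀ z ∈ B, DifferentiableAt ℝ g z)
    (hg' : ∀ z ∈ B, fderiv ℝ g z (horizontalUnit n) ∈ horizontalLine n)
    {z w : EuclideanSpace ℂ (Fin n)} (hz : z ∈ B) (hw : w ∈ B)
    (hzw : z - w ∈ horizontalLine n) : g z - g w ∈ horizontalLine n := by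
  obtain ⟨s, hs⟩ := mem_horizontalLine_iff_exists.1 hzw
  have hmem : ∀ t ∈ Icc (0 : ℝ) 1, w + (t * s) • horizontalUnit n ∈ B := by
    intro t ht
    have := hB.add_smul_sub_mem hw hz ht
    rwa [hs, smul_smul] at this
  have hd : ∀ t ∈ Icc (0 : ℝ) 1,
      HasDerivAt (fun t : ℝ => transverseProj n (g (w + (t * s) • horizontalUnit n))) 0 t := by
    intro t ht
    have h1 : HasDerivAt (fun t : ℝ => w + (t * s) • horizontalUnit n)
        (s • horizontalUnit n) t := by
      simpa using (((hasDerivAt_id t).mul_const s).smul_const (horizontalUnit n)).const_add w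
    have h2 := (hg _ (hmem t ht)).hasFDerivAt.comp_hasDerivAt t h1
    have h3 := (transverseProj n).hasFDerivAt.comp_hasDerivAt t h2
    rw [map_smul, map_smul, mem_horizontalLine_iff_transverseProj.1 (hg' _ (hmem t ht)),
      smul_zero] at h3
    exact h3
  have := constant_of_has_deriv_right_zero
    (fun t ht => (hd t ht).continuousAt.continuousWithinAt)
    (fun t ht => (hd t ⟨ht.1, ht.2.le⟩).hasDerivWithinAt) 1 ⟨zero_le_one, le_rfl⟩
  rw [mem_horizontalLine_iff_transverseProj, map_sub, sub_eq_zero]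
  have hz' : w + s • horizontalUnit n = z := by rw [← hs]; abel
  simpa [hz'] using this

end Line

/-! ### Biholomorphisms: composition, restriction, translations, dilations -/

section Maps

variable {n : ℕ} {M N K : Type*}
  [TopologicalSpace M] [ChartedSpace (EuclideanSpace ℂ (Fin n)) M]
  [TopologicalSpace N] [ChartedSpace (EuclideanSpace ℂ (Fin n)) N]
  [TopologicalSpace K] [ChartedSpace (EuclideanSpace ℂ (Fin n)) K]

theorem IsBiholo.symm {f : OpenPartialHomeomorph M N} (hf : IsBiholo n f) :
    IsBiholo n f.symm := ⟨hf.2, by simpa using hf.1⟩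

theorem IsBiholo.trans {f : OpenPartialHomeomorph M N} {g : OpenPartialHomeomorph N K}
    (hf : IsBiholo n f) (hg : IsBiholo n g) : IsBiholo n (f.trans g) := by
  constructor
  · rw [OpenPartialHomeomorph.coe_trans, OpenPartialHomeomorph.trans_source]
    exact hg.1.comp (hf.1.mono inter_subset_left) (fun x hx => hx.2)
  · rw [OpenPartialHomeomorph.coe_trans_symm, OpenPartialHomeomorph.trans_target]
    exact hf.2.comp (hg.2.mono inter_subset_left) (fun x hx => hx.2)

theorem IsBiholo.restr {f : OpenPartialHomeomorph M N} (hf : IsBiholo n f) (s : Set M) :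
    IsBiholo n (f.restr s) := by
  constructor
  · rw [f.restr_source]
    exact hf.1.mono inter_subset_left
  · refine hf.2.mono fun y hy => ?_
    rw [OpenPartialHomeomorph.restr] at hy
    exact hy.1

theorem isBiholo_refl : IsBiholo n (OpenPartialHomeomorph.refl M) :=
  ⟨contMDiffOn_id, contMDiffOn_id⟩

theorem ContMDiffOn.restrictScalars_complex {f : M → N} {s : Set M}
    (hf : ContMDiffOn 𝓘(ℂ, EuclideanSpace ℂ (Fin n)) 𝓘(ℂ, EuclideanSpace ℂ (Fin n)) ω f s) :
    ContMDiffOn 𝓘(ℝ, EuclideanSpace ℂ (Fin n)) 𝓘(ℝ, EuclideanSpace ℂ (Fin n)) ∞ f s := by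
  intro x hx
  have h := hf x hx
  rw [contMDiffWithinAt_iff] at h ⊢
  exact ⟨h.1, (h.2.restrict_scalars ℝ).of_le le_top⟩

theorem IsBiholo.isRealDiffeo {f : OpenPartialHomeomorph M N} (hf : IsBiholo n f) :
    IsRealDiffeo n f :=
  ⟨hf.1.restrictScalars_complex, hf.2.restrictScalars_complex⟩

end Maps

section Translation

variable {n : ℕ}

/-- Translation of `ℂⁿ` by a fixed vector. -/
noncomputable def translation (u : EuclideanSpace ℂ (Fin n)) :
    OpenPartialHomeomorph (EuclideanSpace ℂ (Fin n)) (EuclideanSpace ℂ (Fin n)) :=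
  (Homeomorph.addRight u).toOpenPartialHomeomorph

theorem isBiholo_translation (u : EuclideanSpace ℂ (Fin n)) : IsBiholo n (translation u) := by
  constructor
  · refine ContMDiff.contMDiffOn (contMDiff_iff_contDiff.2 ?_)
    exact contDiff_id.add contDiff_const
  · refine ContMDiff.contMDiffOn (contMDiff_iff_contDiff.2 ?_)
    exact contDiff_id.add contDiff_const

/-- Multiplication of `ℂⁿ` by a nonzero real number. -/
noncomputable def dilation (c : ℝˣ) :
    OpenPartialHomeomorph (EuclideanSpace ℂ (Fin n)) (EuclideanSpace ℂ (Fin n)) :=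
  (Homeomorph.smulOfNeZero (c : ℝ) c.ne_zero).toOpenPartialHomeomorph

theorem isBiholo_dilation (c : ℝˣ) : IsBiholo n (dilation (n := n) c) := by
  constructor
  · refine ContMDiff.contMDiffOn (contMDiff_iff_contDiff.2 ?_)
    exact contDiff_id.const_smul (c : ℝ)
  · refine ContMDiff.contMDiffOn (contMDiff_iff_contDiff.2 ?_)
    exact contDiff_id.const_smul ((c : ℝ)⁻¹)

end Translation

section Rescale

variable {n : ℕ} {X : Type*} [TopologicalSpace X]

/-- A chart followed by multiplication by a nonzero real number. -/
noncomputable def OpenPartialHomeomorph.rescale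
    (e : OpenPartialHomeomorph X (EuclideanSpace ℂ (Fin n))) (c : ℝˣ) :
    OpenPartialHomeomorph X (EuclideanSpace ℂ (Fin n)) :=
  e.transHomeomorph (Homeomorph.smulOfNeZero (c : ℝ) c.ne_zero)

variable (e : OpenPartialHomeomorph X (EuclideanSpace ℂ (Fin n))) (c : ℝˣ)

@[simp] theorem OpenPartialHomeomorph.rescale_source : (e.rescale c).source = e.source := rfl

@[simp] theorem OpenPartialHomeomorph.rescale_apply (x : X) : e.rescale c x = (c : ℝ) • e x := rfl

@[simp] theorem OpenPartialHomeomorph.rescale_symm_apply (z : EuclideanSpace ℂ (Fin n)) :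
    (e.rescale c).symm z = e.symm ((c : ℝ)⁻¹ • z) := rfl

theorem OpenPartialHomeomorph.mem_rescale_target {z : EuclideanSpace ℂ (Fin n)} :
    z ∈ (e.rescale c).target ↔ (c : ℝ)⁻¹ • z ∈ e.target := Iff.rfl

theorem IsBiholo.rescale [ChartedSpace (EuclideanSpace ℂ (Fin n)) X]
    {e : OpenPartialHomeomorph X (EuclideanSpace ℂ (Fin n))} (he : IsBiholo n e) (c : ℝˣ) :
    IsBiholo n (e.rescale c) := by
  rw [OpenPartialHomeomorph.rescale, OpenPartialHomeomorph.transHomeomorph_eq_trans]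
  exact he.trans (isBiholo_dilation c)

end Rescale

/-! ### Holomorphic charts and the leaf topology -/

namespace SmoothFoliation

variable {n : ℕ} [NeZero n] {X : Type*} [TopologicalSpace X]
  [ChartedSpace (EuclideanSpace ℂ (Fin n)) X] (F : SmoothFoliation n X)

/-- The holomorphic charts for a foliation. -/
def holoCharts : Set (OpenPartialHomeomorph X (EuclideanSpace ℂ (Fin n))) :=
  {e | e ∈ F.charts ∧ IsBiholo n e}

variable {F}

/-- A nonzero real scaling preserves the horizontal line, so maximality of the atlas applies.
Rescaled charts absorb the constant factor that appears when one passes from chart to chart. -/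
theorem rescale_mem_holoCharts {e : OpenPartialHomeomorph X (EuclideanSpace ℂ (Fin n))}
    (he : e ∈ F.holoCharts) (c : ℝˣ) : e.rescale c ∈ F.holoCharts := by
  refine ⟨F.maximal _ (he.2.rescale c).isRealDiffeo fun e' he' p hp => ?_, he.2.rescale c⟩
  obtain ⟨O, hO, hOs, h⟩ := F.compatible e he.1 e' he' p hp
  refine ⟨O, hO, hOs, fun x hx y hy => ?_⟩
  rw [← h x hx y hy, OpenPartialHomeomorph.rescale_apply, OpenPartialHomeomorph.rescale_apply,
    ← smul_sub]
  exact Submodule.smul_mem_iff _ c.ne_zero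

/-- By compatibility, the plaques through `x` in all charts agree near `x`, so the single chart `e`
determines the leaf topology there. -/
theorem nhds_leafTopology {e : OpenPartialHomeomorph X (EuclideanSpace ℂ (Fin n))}
    (he : e ∈ F.charts) {x : X} (hx : x ∈ e.source) :
    @nhds X F.leafTopology x = 𝓝 x ⊓ 𝓟 {y | e y - e x ∈ horizontalLine n} := by
  apply le_antisymm
  · refine le_inf (fun O hO => ?_) ?_
    · obtain ⟨O', hO'O, hO', hxO'⟩ := mem_nhds_iff.1 hO
      refine (@mem_nhds_iff X F.leafTopology _ _).2
        ⟨{y | y ∈ O' ∧ y ∈ e.source ∧ e y - e x ∈ horizontalLine n}, fun y hy => hO'O hy.1,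
          TopologicalSpace.isOpen_generateFrom_of_mem ⟨e, he, e x, O', hO', rfl⟩, hxO', hx, by simp⟩
    · refine le_principal_iff.2 ((@mem_nhds_iff X F.leafTopology _ _).2
        ⟨{y | y ∈ univ ∧ y ∈ e.source ∧ e y - e x ∈ horizontalLine n}, fun y hy => hy.2.2,
          TopologicalSpace.isOpen_generateFrom_of_mem ⟨e, he, e x, univ, isOpen_univ, rfl⟩,
          mem_univ _, hx, by simp⟩)
  · rw [TopologicalSpace.nhds_generateFrom]
    refine le_iInf₂ fun A hA => ?_
    obtain ⟨hxA, e', he', z, O, hO, rfl⟩ := hA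
    obtain ⟨O', hO', hO's, h⟩ := F.compatible e he e' he' x ⟨hx, hxA.2.1⟩
    refine le_principal_iff.2 ?_
    filter_upwards [mem_inf_of_left hO', mem_inf_of_left (hO.mem_nhds hxA.1),
      mem_inf_of_right (mem_principal_self _)] with y hy hyO hyL
    refine ⟨hyO, (hO's hy).2, ?_⟩
    have := (h y hy x (mem_of_mem_nhds hO')).1 hyL
    simpa using Submodule.add_mem _ this hxA.2.2

theorem leafTopology_le : F.leafTopology ≤ ‹TopologicalSpace X› := by
  rw [← continuous_id_iff_le, @continuous_iff_continuousAt]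
  intro x
  obtain ⟨e, he, hx⟩ := F.cover x
  change @nhds X F.leafTopology x ≤ 𝓝 x
  rw [nhds_leafTopology he hx]
  exact inf_le_left

theorem leafTopology_t2 [T2Space X] : @T2Space X F.leafTopology :=
  @T2Space.of_injective_continuous X X F.leafTopology _ _ id Function.injective_id
    (continuous_id_iff_le.2 leafTopology_le)

end SmoothFoliation

/-! ### Rigidity of transitions between holomorphic charts -/

/-- A holomorphic function with real values has zero derivative. -/
theorem fderiv_eq_zero_of_im_eq_zero {E : Type*} [NormedAddCommGroup E] [NormedSpace ℂ E]
    {f : E → ℂ} {z : E} (hf : DifferentiableAt ℂ f z) (him : ∀ᶠ w in 𝓝 z, (f w).im = 0) :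
    fderiv ℂ f z = 0 := by
  have h1 : HasFDerivAt (fun w => (f w).im)
      (Complex.imCLM.comp ((fderiv ℂ f z).restrictScalars ℝ)) z :=
    Complex.imCLM.hasFDerivAt.comp z (hf.hasFDerivAt.restrictScalars ℝ)
  have h2 : HasFDerivAt (fun w => (f w).im) (0 : E →L[ℝ] ℝ) z :=
    (hasFDerivAt_const (0 : ℝ) z).congr_of_eventuallyEq him
  have h3 : ∀ v, (fderiv ℂ f z v).im = 0 := fun v => by
    simpa using congrArg (fun l : E →L[ℝ] ℝ => l v) (h1.unique h2)
  ext v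
  -- By complex linearity, the imaginary part at `I • v` is the real part at `v`.
  have h4 := h3 (Complex.I • v)
  rw [map_smul] at h4
  apply Complex.ext
  · simpa using h4
  · simpa using h3 v

section Rigidity

variable {n : ℕ} [NeZero n]

/-- A biholomorphism that takes horizontal lines to horizontal lines stretches
them locally by a constant real factor. -/
theorem exists_horizontal_factor {g : EuclideanSpace ℂ (Fin n) → EuclideanSpace ℂ (Fin n)}
    {z₀ : EuclideanSpace ℂ (Fin n)} (hg : AnalyticAt ℂ g z₀)
    (hinj : ∀ᶠ z in 𝓝 z₀, ∀ᶠ w in 𝓝 z₀, g z = g w → z = w)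
    (hL : ∀ᶠ z in 𝓝 z₀, ∀ᶠ w in 𝓝 z, g w - g z ∈ horizontalLine n ∨ w - z ∉ horizontalLine n) :
    ∃ c : ℝˣ, ∃ r > 0, ∀ z ∈ Metric.ball z₀ r, ∀ s : ℝ,
      z + s • horizontalUnit n ∈ Metric.ball z₀ r →
      g (z + s • horizontalUnit n) = g z + ((c : ℝ) * s) • horizontalUnit n := by
  obtain ⟨r, hr, hball⟩ := Metric.eventually_nhds_iff_ball.1 ((hg.eventually_analyticAt).and hL)
  have hd : ∀ z ∈ Metric.ball z₀ r, DifferentiableAt ℂ g z := fun z hz =>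
    (hball z hz).1.differentiableAt
  have hline : ∀ z : EuclideanSpace ℂ (Fin n), ∀ t : ℝ,
      HasDerivAt (fun s : ℝ => z + s • horizontalUnit n) (horizontalUnit n) t := fun z t => by
    simpa using ((hasDerivAt_id t).smul_const (horizontalUnit n)).const_add z
  have hmem : ∀ z ∈ Metric.ball z₀ r, fderiv ℂ g z (horizontalUnit n) ∈ horizontalLine n := by
    intro z hz
    have h1 : HasDerivAt (fun s : ℝ => g (z + s • horizontalUnit n))
        (fderiv ℂ g z (horizontalUnit n)) 0 :=
      ((hd z hz).hasFDerivAt.restrictScalars ℝ).comp_hasDerivAt_of_eq 0 (hline z 0) (by simp)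
    refine h1.mem_horizontalLine ?_
    have hc : Tendsto (fun s : ℝ => z + s • horizontalUnit n) (𝓝 0) (𝓝 z) := by
      simpa using (hline z 0).continuousAt.tendsto
    filter_upwards [hc.eventually (hball z hz).2] with s hs
    rcases hs with hs | hs
    · simpa using hs
    · exact absurd (by simpa using smul_horizontalUnit_mem s) hs
  -- The first component of ∂g/∂z₁ is holomorphic, and real because the derivative is horizontal;
  -- hence it is constant on the ball.
  set a : EuclideanSpace ℂ (Fin n) → ℂ := fun z => fderiv ℂ g z (horizontalUnit n) 0 with ha
  have had : ∀ z ∈ Metric.ball z₀ r, DifferentiableAt ℂ a z := by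
    intro z hz
    have h1 : DifferentiableAt ℂ (fun z => fderiv ℂ g z (horizontalUnit n)) z :=
      ((hball z hz).1.fderiv.differentiableAt).clm_apply (differentiableAt_const _)
    exact ((EuclideanSpace.proj (𝕜 := ℂ) (0 : Fin n)).differentiableAt).comp z h1
  have hz₀ : z₀ ∈ Metric.ball z₀ r := Metric.mem_ball_self hr
  have haconst : ∀ z ∈ Metric.ball z₀ r, a z = a z₀ := by
    intro z hz
    refine (convex_ball z₀ r).is_const_of_fderivWithin_eq_zero (𝕜 := ℂ)
      (fun w hw => (had w hw).differentiableWithinAt) (fun w hw => ?_) hz hz₀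
    rw [fderivWithin_of_isOpen Metric.isOpen_ball hw]
    refine fderiv_eq_zero_of_im_eq_zero (had w hw) ?_
    filter_upwards [Metric.isOpen_ball.mem_nhds hw] with y hy
    exact (hmem y hy).1
  set c : ℝ := (a z₀).re with hc
  have hfd : ∀ z ∈ Metric.ball z₀ r,
      fderiv ℂ g z (horizontalUnit n) = c • horizontalUnit n := by
    intro z hz
    rw [hc, ← haconst z hz]
    exact mem_horizontalLine_iff.1 (hmem z hz)
  have key : ∀ z ∈ Metric.ball z₀ r, ∀ s : ℝ, z + s • horizontalUnit n ∈ Metric.ball z₀ r →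
      g (z + s • horizontalUnit n) = g z + (c * s) • horizontalUnit n := by
    intro z hz s hs
    have hseg : ∀ t ∈ Icc (0 : ℝ) 1, z + (t * s) • horizontalUnit n ∈ Metric.ball z₀ r := by
      intro t ht
      have := (convex_ball z₀ r).add_smul_sub_mem hz hs ht
      simpa [smul_smul] using this
    have hder : ∀ t ∈ Icc (0 : ℝ) 1, HasDerivAt (fun t : ℝ =>
        g (z + (t * s) • horizontalUnit n) - (c * (t * s)) • horizontalUnit n) 0 t := by
      intro t ht
      have h1 : HasDerivAt (fun t : ℝ => z + (t * s) • horizontalUnit n)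
          (s • horizontalUnit n) t := by
        simpa using (((hasDerivAt_id t).mul_const s).smul_const (horizontalUnit n)).const_add z
      have h2 := ((hd _ (hseg t ht)).hasFDerivAt.restrictScalars ℝ).comp_hasDerivAt t h1
      have h3 : HasDerivAt (fun t : ℝ => (c * (t * s)) • horizontalUnit n)
          ((c * s) • horizontalUnit n) t := by
        simpa using ((((hasDerivAt_id t).mul_const s).const_mul c).smul_const (horizontalUnit n))
      have h4 := h2.sub h3
      rw [map_smul, ContinuousLinearMap.coe_restrictScalars', hfd _ (hseg t ht), smul_smul,
        mul_comm s c, sub_self] at h4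
      exact h4
    have := constant_of_has_deriv_right_zero
      (fun t ht => (hder t ht).continuousAt.continuousWithinAt)
      (fun t ht => (hder t ⟨ht.1, ht.2.le⟩).hasDerivWithinAt) 1 ⟨zero_le_one, le_rfl⟩
    simp only [one_mul, zero_mul, mul_zero, zero_smul, add_zero, sub_zero] at this
    rw [← this]; abel
  -- A zero factor would make `g` constant on horizontal segments through `z₀`, against injectivity.
  have hc0 : c ≠ 0 := by
    intro h0
    have hc : Tendsto (fun s : ℝ => z₀ + s • horizontalUnit n) (𝓝 0) (𝓝 z₀) := by
      simpa using (hline z₀ 0).continuousAt.tendsto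
    have hev := (hc.eventually hinj.self_of_nhds).and
      (hc.eventually (Metric.isOpen_ball.mem_nhds hz₀))
    obtain ⟨s, ⟨hs, hsb⟩, hs0⟩ :=
      ((hev.filter_mono nhdsWithin_le_nhds).and
        (self_mem_nhdsWithin : ∀ᶠ s in 𝓝[≠] (0 : ℝ), s ∈ ({0}ᶜ : Set ℝ))).exists
    have h1 := key z₀ hz₀ s hsb
    rw [h0, zero_mul, zero_smul, add_zero] at h1
    have h2 := hs h1.symm
    rw [left_eq_add, smul_eq_zero] at h2
    exact h2.elim hs0 horizontalUnit_ne_zero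
  exact ⟨Units.mk0 c hc0, r, hr, key⟩

end Rigidity

/-! ### Unit translations in overlapping charts -/

section Flow

variable {n : ℕ} [NeZero n] {X : Type*} [TopologicalSpace X]

/-- Near `y`, horizontal unit translation in the charts `e` and `e'` gives the same curve
through `y`. -/
def SameFlow (e e' : OpenPartialHomeomorph X (EuclideanSpace ℂ (Fin n))) (y : X) : Prop :=
  ∀ᶠ s : ℝ in 𝓝 0, e.symm (e y + s • horizontalUnit n) = e'.symm (e' y + s • horizontalUnit n)

theorem tendsto_add_smul_horizontalUnit (z : EuclideanSpace ℂ (Fin n)) :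
    Tendsto (fun s : ℝ => z + s • horizontalUnit n) (𝓝 0) (𝓝 z) := by
  have : Continuous fun s : ℝ => z + s • horizontalUnit n := by fun_prop
  simpa using this.tendsto 0

namespace SmoothFoliation

variable [ChartedSpace (EuclideanSpace ℂ (Fin n)) X] {F : SmoothFoliation n X}

/-- After rescaling one of them, two holomorphic charts have the same horizontal curves
near a common point, with the same parametrization. -/
theorem exists_rescale_sameFlow {e e' : OpenPartialHomeomorph X (EuclideanSpace ℂ (Fin n))}
    (he : e ∈ F.holoCharts) (he' : e' ∈ F.holoCharts) {x : X} (hx : x ∈ e.source)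
    (hx' : x ∈ e'.source) :
    ∃ c : ℝˣ, ∀ᶠ y in 𝓝 x, y ∈ e.source ∧ y ∈ e'.source ∧ SameFlow e (e'.rescale c) y := by
  set g : EuclideanSpace ℂ (Fin n) → EuclideanSpace ℂ (Fin n) := fun z => e' (e.symm z) with hg
  have hsymm : Tendsto e.symm (𝓝 (e x)) (𝓝 x) := by
    simpa [ContinuousAt, e.left_inv hx] using e.continuousAt_symm (e.map_source hx)
  have hΩ : ∀ᶠ z in 𝓝 (e x), z ∈ e.target ∧ e.symm z ∈ e'.source :=
    (e.open_target.eventually_mem (e.map_source hx)).and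
      (hsymm.eventually (e'.open_source.mem_nhds hx'))
  have han : AnalyticAt ℂ g (e x) := by
    have h1 := (he.2.symm.trans he'.2).1
    rw [contMDiffOn_iff_contDiffOn] at h1
    refine ContDiffAt.analyticAt (h1.contDiffAt ?_)
    filter_upwards [hΩ] with z hz
    simpa using hz
  obtain ⟨O, hO, hOs, h⟩ := F.compatible e he.1 e' he'.1 x ⟨hx, hx'⟩
  have hO' : ∀ᶠ z in 𝓝 (e x), z ∈ e.target ∧ e.symm z ∈ O := hΩ.and (hsymm.eventually hO) |>.mono
    fun z hz => ⟨hz.1.1, hz.2⟩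
  obtain ⟨c, r, hr, hc⟩ := exists_horizontal_factor han
    (by
      filter_upwards [hΩ] with z hz
      filter_upwards [hΩ] with w hw hzw
      exact e.symm.injOn hz.1 hw.1 (e'.injOn hz.2 hw.2 hzw))
    (by
      filter_upwards [hO'.eventually_nhds] with z hz
      filter_upwards [hz] with w hw
      have hz := hz.self_of_nhds
      by_cases hL : w - z ∈ horizontalLine n
      · left
        refine (h _ hw.2 _ hz.2).1 ?_
        rwa [e.right_inv hw.1, e.right_inv hz.1]
      · exact Or.inr hL)
  -- The transition from `e` to `e'` stretches horizontally by `c`, so dividing `e'` by `c` restores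
  -- unit speed.
  refine ⟨c⁻¹, ?_⟩
  have hball : ∀ᶠ z in 𝓝 (e x), z ∈ Metric.ball (e x) r ∧ z ∈ e.target ∧ e.symm z ∈ e'.source :=
    (Metric.isOpen_ball.eventually_mem (Metric.mem_ball_self hr)).and hΩ
  filter_upwards [(e.continuousAt hx).eventually hball.eventually_nhds,
    e.open_source.mem_nhds hx, e'.open_source.mem_nhds hx'] with y hy hys hys'
  refine ⟨hys, hys', ?_⟩
  filter_upwards [(tendsto_add_smul_horizontalUnit (e y)).eventually hy] with s hs
  have h1 := hc _ hy.self_of_nhds.1 s hs.1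
  simp only [hg, e.left_inv hys] at h1
  rw [OpenPartialHomeomorph.rescale_symm_apply, OpenPartialHomeomorph.rescale_apply, smul_add,
    smul_smul, smul_smul, Units.val_inv_eq_inv_val, inv_inv, mul_inv_cancel₀ c.ne_zero, one_smul,
    ← h1, e'.left_inv hs.2.2]

end SmoothFoliation

end Flow

/-! ### Affine curves: unique continuation and maximal curves -/

section AffineCurves

variable {n : ℕ} [NeZero n] {X : Type*} [TopologicalSpace X]

/-- Near time `t`, the curve `γ` is the horizontal unit translation in the chart `e`. -/
def AffineAt (e : OpenPartialHomeomorph X (EuclideanSpace ℂ (Fin n))) (γ : ℝ → X) (t : ℝ) :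
    Prop :=
  γ t ∈ e.source ∧ ∀ᶠ s in 𝓝 t, γ s = e.symm (e (γ t) + (s - t) • horizontalUnit n)

variable {e e' : OpenPartialHomeomorph X (EuclideanSpace ℂ (Fin n))} {γ γ' : ℝ → X} {t : ℝ}

theorem tendsto_sub_nhds_zero (t : ℝ) : Tendsto (fun s : ℝ => s - t) (𝓝 t) (𝓝 0) := by
  have : Continuous fun s : ℝ => s - t := by fun_prop
  simpa using this.tendsto t

theorem AffineAt.eventually_chart (h : AffineAt e γ t) :
    ∀ᶠ s in 𝓝 t, γ s ∈ e.source ∧ e (γ s) = e (γ t) + (s - t) • horizontalUnit n := by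
  have h1 := (tendsto_add_smul_horizontalUnit (e (γ t))).comp (tendsto_sub_nhds_zero t)
  filter_upwards [h.2, h1.eventually (e.open_target.mem_nhds (e.map_source h.1))] with s hs hs'
  rw [hs]
  exact ⟨e.map_target hs', e.right_inv hs'⟩

theorem AffineAt.continuousAt (h : AffineAt e γ t) : ContinuousAt γ t := by
  have h1 := (tendsto_add_smul_horizontalUnit (e (γ t))).comp (tendsto_sub_nhds_zero t)
  have h2 : Tendsto e.symm (𝓝 (e (γ t))) (𝓝 (γ t)) := by
    simpa [ContinuousAt, e.left_inv h.1] using e.continuousAt_symm (e.map_source h.1)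
  exact (h2.comp h1).congr' (h.2.mono fun s hs => hs.symm)

theorem AffineAt.congr (h : AffineAt e γ t) (hγ : γ' =ᶠ[𝓝 t] γ) : AffineAt e γ' t := by
  refine ⟨hγ.self_of_nhds ▸ h.1, ?_⟩
  filter_upwards [hγ, h.2] with s hs hs'
  rw [hs, hs', hγ.self_of_nhds]

theorem SameFlow.symm {y : X} (h : SameFlow e e' y) : SameFlow e' e y :=
  h.mono fun _ hs => hs.symm

theorem AffineAt.of_sameFlow (h : AffineAt e γ t) (he' : γ t ∈ e'.source)
    (h' : SameFlow e e' (γ t)) : AffineAt e' γ t := by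
  refine ⟨he', ?_⟩
  filter_upwards [h.2, (tendsto_sub_nhds_zero t).eventually h'] with s hs hs'
  rw [hs, hs']

/-- A time change by the factor `c` gives speed `c` in `e`, hence unit speed after division by `c`.
A negative `c` reverses the direction. -/
theorem AffineAt.comp_affine (h : AffineAt e γ t) {c : ℝˣ} {u b : ℝ} (hu : (c : ℝ) * u + b = t) :
    AffineAt (e.rescale c⁻¹) (fun v => γ (c * v + b)) u := by
  subst hu
  refine ⟨h.1, ?_⟩
  have hc : Tendsto (fun v : ℝ => (c : ℝ) * v + b) (𝓝 u) (𝓝 (c * u + b)) :=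
    (by fun_prop : Continuous fun v : ℝ => (c : ℝ) * v + b).tendsto u
  filter_upwards [hc.eventually h.2] with v hv
  rw [hv, OpenPartialHomeomorph.rescale_symm_apply, OpenPartialHomeomorph.rescale_apply, smul_add,
    smul_smul, smul_smul, Units.val_inv_eq_inv_val, inv_inv, mul_inv_cancel₀ c.ne_zero, one_smul]
  congr 3
  ring

theorem affineAt_line {z : EuclideanSpace ℂ (Fin n)} {t₀ : ℝ}
    (hz : z + (t - t₀) • horizontalUnit n ∈ e.target) :
    AffineAt e (fun s => e.symm (z + (s - t₀) • horizontalUnit n)) t := by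
  refine ⟨e.map_target hz, Eventually.of_forall fun s => ?_⟩
  dsimp only
  rw [e.right_inv hz, add_assoc, ← add_smul]
  congr 3
  ring

/-- Nearby points of an affine curve are distinct. -/
theorem AffineAt.eventually_injective (h : AffineAt e γ t) :
    ∃ N ∈ 𝓝 t, InjOn γ N := by
  refine ⟨_, h.eventually_chart, fun s hs s' hs' hss => ?_⟩
  have h1 := hs.2.symm.trans ((congrArg e hss).trans hs'.2)
  have := smul_horizontalUnit_injective (add_left_cancel h1)
  linarith

/-- One common value at a nearby time `s ≠ t` is enough: the displacement along the unit vector is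
`s - t` both in `e` and in `c` times `e`. -/
theorem AffineAt.rescale_eq_one {c : ℝˣ} (h : AffineAt e γ t) (h' : AffineAt (e.rescale c) γ' t)
    (hγ : ∃ᶠ s in 𝓝[≠] t, γ s = γ' s) (hγ' : γ t = γ' t) : c = 1 := by
  obtain ⟨s, hs, ⟨h1, h2⟩, hst⟩ := (hγ.and_eventually
    (((h.eventually_chart.and h'.eventually_chart).filter_mono nhdsWithin_le_nhds).and
      (self_mem_nhdsWithin : ∀ᶠ s in 𝓝[≠] t, s ∈ ({t}ᶜ : Set ℝ)))).exists
  have h3 := h2.2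
  rw [OpenPartialHomeomorph.rescale_apply, OpenPartialHomeomorph.rescale_apply, ← hs, h1.2, hγ',
    smul_add, add_right_inj, smul_smul] at h3
  have h4 := smul_horizontalUnit_injective h3
  have h5 : s - t ≠ 0 := sub_ne_zero.2 hst
  exact Units.ext (mul_right_cancel₀ h5 (by simpa using h4))

namespace SmoothFoliation

variable [ChartedSpace (EuclideanSpace ℂ (Fin n)) X] {F : SmoothFoliation n X} {I J : Set ℝ}

variable (F) in
/-- A curve in a leaf that is a horizontal unit translation in suitable holomorphic charts. -/
def IsAffineOn (γ : ℝ → X) (I : Set ℝ) : Prop :=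
  ∀ t ∈ I, ∃ e ∈ F.holoCharts, AffineAt e γ t

theorem IsAffineOn.mono (h : F.IsAffineOn γ I) (hJ : J ⊆ I) : F.IsAffineOn γ J :=
  fun t ht => h t (hJ ht)

theorem IsAffineOn.comp_affine (h : F.IsAffineOn γ I) (c : ℝˣ) (b : ℝ)
    (hJ : ∀ u ∈ J, (c : ℝ) * u + b ∈ I) : F.IsAffineOn (fun v => γ (c * v + b)) J := by
  intro u hu
  obtain ⟨e, he, h⟩ := h _ (hJ u hu)
  exact ⟨e.rescale c⁻¹, rescale_mem_holoCharts he _, h.comp_affine rfl⟩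

/-- An affine curve is a rescaled unit translation in each holomorphic chart. -/
theorem exists_rescale_affineAt {e e' : OpenPartialHomeomorph X (EuclideanSpace ℂ (Fin n))}
    (he : e ∈ F.holoCharts) (he' : e' ∈ F.holoCharts) (h : AffineAt e γ t)
    (hx : γ t ∈ e'.source) : ∃ c : ℝˣ, AffineAt (e'.rescale c) γ t := by
  obtain ⟨c, hc⟩ := exists_rescale_sameFlow he he' h.1 hx
  exact ⟨c, h.of_sameFlow hx hc.self_of_nhds.2.2⟩

/-- If two affine curves agree near `t`, their charts have the same flow near the common point. -/
theorem eventually_sameFlow {e e' : OpenPartialHomeomorph X (EuclideanSpace ℂ (Fin n))}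
    (he : e ∈ F.holoCharts) (he' : e' ∈ F.holoCharts) (h : AffineAt e γ t)
    (h' : AffineAt e' γ' t) (hγ : ∃ᶠ s in 𝓝[≠] t, γ s = γ' s) (hγ' : γ t = γ' t) :
    ∀ᶠ y in 𝓝 (γ t), y ∈ e.source ∧ y ∈ e'.source ∧ SameFlow e e' y := by
  obtain ⟨c, hc⟩ := exists_rescale_sameFlow he he' h.1 (hγ' ▸ h'.1)
  have h1 : AffineAt (e'.rescale c) γ t := h.of_sameFlow (hγ' ▸ h'.1) hc.self_of_nhds.2.2
  -- Agreement along one curve fixes the factor, and the factor is the same for all nearby points,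
  -- on other leaves as well.
  have h2 : c = 1 := h'.rescale_eq_one h1 (hγ.mono fun s hs => hs.symm) hγ'.symm
  subst h2
  filter_upwards [hc] with y hy
  refine ⟨hy.1, hy.2.1, ?_⟩
  simpa [SameFlow] using hy.2.2

/-- Affine curves that agree near one time agree as long as both are defined. -/
theorem IsAffineOn.eventuallyEq [T2Space X] (h : F.IsAffineOn γ I) (h' : F.IsAffineOn γ' I)
    (hI : IsPreconnected I) {t₀ : ℝ} (ht₀ : t₀ ∈ I) (h₀ : γ =ᶠ[𝓝 t₀] γ') {t : ℝ} (ht : t ∈ I) :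
    γ =ᶠ[𝓝 t] γ' := by
  have hopen : IsOpen {t | γ =ᶠ[𝓝 t] γ'} := isOpen_iff_mem_nhds.2 fun s hs =>
    eventually_eventually_nhds.2 hs
  -- The set of times at which the germs agree is open; by connectedness of `I` it remains to see
  -- that it is closed in `I`.
  refine hI.subset_of_closure_inter_subset (u := {t | γ =ᶠ[𝓝 t] γ'}) hopen ⟨t₀, ht₀, h₀⟩ ?_ ht
  rintro s ⟨hs, hsI⟩
  obtain ⟨e, he, hγ⟩ := h s hsI
  obtain ⟨e', he', hγ'⟩ := h' s hsI
  by_cases hsu : γ =ᶠ[𝓝 s] γ'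
  · exact hsu
  have hfreq0 : ∃ᶠ r in 𝓝 s, γ =ᶠ[𝓝 r] γ' := mem_closure_iff_frequently.1 hs
  -- At a limit of times of agreement the values coincide because `X` is Hausdorff.
  have heq : γ s = γ' s := by
    by_contra hne
    obtain ⟨U, V, hU, hV, hsU, hsV, hUV⟩ := t2_separation hne
    obtain ⟨r, hr, hrU, hrV⟩ := (hfreq0.and_eventually
      ((hγ.continuousAt.eventually (hU.mem_nhds hsU)).and
        (hγ'.continuousAt.eventually (hV.mem_nhds hsV)))).exists
    exact disjoint_left.1 hUV hrU (hr.self_of_nhds ▸ hrV)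
  have hfreq : ∃ᶠ r in 𝓝[≠] s, γ r = γ' r := by
    rw [frequently_nhdsWithin_iff]
    refine hfreq0.mono fun r hr => ⟨hr.self_of_nhds, ?_⟩
    rintro rfl
    exact hsu hr
  have := (eventually_sameFlow he he' hγ hγ' hfreq heq).self_of_nhds
  have h3 := hγ.of_sameFlow this.2.1 this.2.2
  filter_upwards [h3.2, hγ'.2] with r hr hr'
  rw [hr, hr', heq]

/-- The maximal affine curve with given initial point and initial velocity. -/
structure IsMaximalAffine (F : SmoothFoliation n X)
    (e : OpenPartialHomeomorph X (EuclideanSpace ℂ (Fin n))) (x : X) (γ : ℝ → X) (I : Set ℝ) :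
    Prop where
  isOpen : IsOpen I
  ordConnected : I.OrdConnected
  zero_mem : 0 ∈ I
  isAffineOn : F.IsAffineOn γ I
  apply_zero : γ 0 = x
  affineAt_zero : AffineAt e γ 0
  maximal : ∀ (J : Set ℝ) (σ : ℝ → X), IsOpen J → J.OrdConnected → 0 ∈ J → F.IsAffineOn σ J →
    σ 0 = x → AffineAt e σ 0 → J ⊆ I ∧ EqOn σ γ J

/-- By unique continuation, any two affine curves with the same germ at time zero agree on their
common interval. Hence all of them glue to one curve on the union of their intervals. -/
theorem exists_isMaximalAffine [T2Space X]
    {e : OpenPartialHomeomorph X (EuclideanSpace ℂ (Fin n))} (he : e ∈ F.holoCharts) {x : X}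
    (hx : x ∈ e.source) : ∃ γ I, IsMaximalAffine F e x γ I := by
  classical
  let C : Set (Set ℝ × (ℝ → X)) := {p | IsOpen p.1 ∧ p.1.OrdConnected ∧ 0 ∈ p.1 ∧
    F.IsAffineOn p.2 p.1 ∧ p.2 0 = x ∧ AffineAt e p.2 0}
  have hagree : ∀ p ∈ C, ∀ q ∈ C, ∀ t ∈ p.1 ∩ q.1, p.2 =ᶠ[𝓝 t] q.2 := by
    rintro p ⟨-, hp2, hp3, hp4, hp5, hp6⟩ q ⟨-, hq2, hq3, hq4, hq5, hq6⟩ t ht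
    refine (hp4.mono inter_subset_left).eventuallyEq (hq4.mono inter_subset_right)
      (hp2.inter hq2).isPreconnected ⟨hp3, hq3⟩ ?_ ht
    filter_upwards [hp6.2, hq6.2] with s hs hs'
    rw [hs, hs', hp5, hq5]
  let I : Set ℝ := ⋃ p ∈ C, p.1
  have hI : ∀ t ∈ I, ∃ p ∈ C, t ∈ p.1 := fun t ht => by simpa [I] using ht
  have : Nonempty X := ⟨x⟩
  choose! P hPC hPI using hI
  let γ : ℝ → X := fun t => (P t).2 t
  have hsub : ∀ p ∈ C, p.1 ⊆ I := fun p hp t ht => mem_iUnion₂.2 ⟨p, hp, ht⟩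
  have hγ : ∀ p ∈ C, ∀ t ∈ p.1, γ t = p.2 t := fun p hp t ht =>
    (hagree _ (hPC t (hsub p hp ht)) p hp t ⟨hPI t (hsub p hp ht), ht⟩).self_of_nhds
  have hγ' : ∀ p ∈ C, ∀ t ∈ p.1, γ =ᶠ[𝓝 t] p.2 := fun p hp t ht => by
    filter_upwards [hp.1.mem_nhds ht] with s hs using hγ p hp s hs
  have hbase : ∃ p, p ∈ C := by
    obtain ⟨r, hr, hball⟩ := Metric.eventually_nhds_iff_ball.1
      ((tendsto_add_smul_horizontalUnit (e x)).eventually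
        (e.open_target.eventually_mem (e.map_source hx)))
    have hline : ∀ t ∈ Metric.ball (0 : ℝ) r,
        AffineAt e (fun s => e.symm (e x + (s - 0) • horizontalUnit n)) t := fun t ht =>
      affineAt_line (by simpa using hball t ht)
    refine ⟨⟨Metric.ball 0 r, fun s => e.symm (e x + (s - 0) • horizontalUnit n)⟩,
      Metric.isOpen_ball, (convex_ball (0 : ℝ) r).ordConnected, Metric.mem_ball_self hr,
      fun t ht => ⟨e, he, hline t ht⟩, by simp [e.left_inv hx],
      hline 0 (Metric.mem_ball_self hr)⟩
  obtain ⟨p₀, hp₀⟩ := hbase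
  refine ⟨γ, I, ?_, ?_, hsub p₀ hp₀ hp₀.2.2.1, ?_, ?_, ?_, ?_⟩
  · exact isOpen_biUnion fun p hp => hp.1
  · refine (isPreconnected_iff_ordConnected).1 ?_
    exact isPreconnected_of_forall 0 fun t ht =>
      ⟨(P t).1, hsub _ (hPC t ht), (hPC t ht).2.2.1, hPI t ht,
        (hPC t ht).2.1.isPreconnected⟩
  · intro t ht
    obtain ⟨e', he', h⟩ := (hPC t ht).2.2.2.1 t (hPI t ht)
    exact ⟨e', he', h.congr (hγ' _ (hPC t ht) t (hPI t ht))⟩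
  · rw [hγ p₀ hp₀ 0 hp₀.2.2.1]; exact hp₀.2.2.2.2.1
  · exact hp₀.2.2.2.2.2.congr (hγ' p₀ hp₀ 0 hp₀.2.2.1)
  · intro J σ h1 h2 h3 h4 h5 h6
    have : (J, σ) ∈ C := ⟨h1, h2, h3, h4, h5, h6⟩
    exact ⟨hsub _ this, fun t ht => (hγ _ this t ht).symm⟩

/-- A maximal affine curve runs through each chart until it leaves it. -/
theorem IsMaximalAffine.extend [T2Space X]
    {e e' : OpenPartialHomeomorph X (EuclideanSpace ℂ (Fin n))} {x : X}
    (h : IsMaximalAffine F e x γ I) (he' : e' ∈ F.holoCharts) (ht : t ∈ I) (h' : AffineAt e' γ t)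
    (hJ : IsOpen J) (hJo : J.OrdConnected) (hJt : t ∈ J)
    (hJe : ∀ s ∈ J, e' (γ t) + (s - t) • horizontalUnit n ∈ e'.target) :
    J ⊆ I ∧ ∀ s ∈ J, γ s = e'.symm (e' (γ t) + (s - t) • horizontalUnit n) := by
  classical
  set σ : ℝ → X := fun s => e'.symm (e' (γ t) + (s - t) • horizontalUnit n) with hσ
  have hσa : ∀ s ∈ J, AffineAt e' σ s := fun s hs => affineAt_line (hJe s hs)
  have hagree : ∀ s ∈ I ∩ J, γ =ᶠ[𝓝 s] σ := fun s hs =>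
    (h.isAffineOn.mono inter_subset_left).eventuallyEq
      (fun r hr => ⟨e', he', hσa r hr.2⟩) (h.ordConnected.inter hJo).isPreconnected ⟨ht, hJt⟩
      h'.2 hs
  let δ : ℝ → X := fun s => if s ∈ I then γ s else σ s
  have hδI : ∀ s ∈ I, δ =ᶠ[𝓝 s] γ := fun s hs => by
    filter_upwards [h.isOpen.mem_nhds hs] with r hr
    simp [δ, hr]
  have hδJ : ∀ s ∈ J, δ =ᶠ[𝓝 s] σ := fun s hs => by
    filter_upwards [hJ.mem_nhds hs] with r hr
    by_cases hrI : r ∈ I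
    · simp [δ, hrI, (hagree r ⟨hrI, hr⟩).self_of_nhds]
    · simp [δ, hrI]
  have hmax := h.maximal (I ∪ J) δ (h.isOpen.union hJ)
    (isPreconnected_iff_ordConnected.1 (h.ordConnected.isPreconnected.union t ht hJt
      hJo.isPreconnected)) (Or.inl h.zero_mem)
    (by
      rintro s (hs | hs)
      · obtain ⟨e'', he'', h''⟩ := h.isAffineOn s hs
        exact ⟨e'', he'', h''.congr (hδI s hs)⟩
      · exact ⟨e', he', (hσa s hs).congr (hδJ s hs)⟩)
    ((hδI 0 h.zero_mem).self_of_nhds.trans h.apply_zero)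
    (h.affineAt_zero.congr (hδI 0 h.zero_mem))
  have hJI : J ⊆ I := subset_union_right.trans hmax.1
  exact ⟨hJI, fun s hs => (hagree s ⟨hJI hs, hs⟩).self_of_nhds⟩

end SmoothFoliation

end AffineCurves

/-! ### Leaves as images of affine curves; betweenness as order of times -/

namespace SmoothFoliation

variable {n : ℕ} [NeZero n] {X : Type*} [TopologicalSpace X]
  [ChartedSpace (EuclideanSpace ℂ (Fin n)) X] {F : SmoothFoliation n X}
  {e e' : OpenPartialHomeomorph X (EuclideanSpace ℂ (Fin n))} {γ γ' : ℝ → X} {t : ℝ}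
  {I J : Set ℝ} {x : X}

/-- The manifold `X` with the leaf topology. -/
def LeafSpace (_F : SmoothFoliation n X) : Type _ := X

instance : TopologicalSpace F.LeafSpace := F.leafTopology

instance [T2Space X] : T2Space F.LeafSpace := leafTopology_t2 (F := F)

variable (F) in
/-- A curve in `X`, as a curve in the leaf topology. -/
def toLeafSpace (γ : ℝ → X) : ℝ → F.LeafSpace := γ

theorem _root_.AffineAt.continuousAt_leaf (he : e ∈ F.holoCharts) (h : AffineAt e γ t) :
    ContinuousAt (F.toLeafSpace γ) t := by
  change Tendsto γ (𝓝 t) (@nhds X F.leafTopology (γ t))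
  rw [nhds_leafTopology he.1 h.1]
  refine tendsto_inf.2 ⟨h.continuousAt, tendsto_principal.2 ?_⟩
  filter_upwards [h.eventually_chart] with s hs
  rw [hs.2, add_sub_cancel_left]
  exact smul_horizontalUnit_mem _

/-- Near `x`, a point of the plaque is recovered from the real part of the first coordinate of its
displacement, which is small. This one-dimensionality makes affine curves open maps into the leaf
topology. -/
theorem plaque_mem_nhds (he : e ∈ F.holoCharts) (hx : x ∈ e.source) {N : Set ℝ}
    (hN : N ∈ 𝓝 (0 : ℝ)) :
    (fun s : ℝ => e.symm (e x + s • horizontalUnit n)) '' N ∈ @nhds X F.leafTopology x := by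
  rw [nhds_leafTopology he.1 hx, mem_inf_principal]
  have h1 : Tendsto (fun y => (e y - e x) 0 |>.re) (𝓝 x) (𝓝 0) := by
    have h2 : Tendsto (fun y => e y - e x) (𝓝 x) (𝓝 0) := by
      simpa using (e.continuousAt hx).tendsto.sub_const (e x)
    have h3 : Continuous fun u : EuclideanSpace ℂ (Fin n) => (u 0).re := by fun_prop
    have h4 := (h3.tendsto 0).comp h2
    rwa [PiLp.zero_apply, Complex.zero_re] at h4
  filter_upwards [h1.eventually hN, e.open_source.mem_nhds hx] with y hy hys hyL
  refine ⟨_, hy, ?_⟩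
  dsimp only
  rw [← mem_horizontalLine_iff.1 hyL, add_sub_cancel, e.left_inv hys]

theorem _root_.AffineAt.image_mem_nhds (he : e ∈ F.holoCharts) (h : AffineAt e γ t) {N : Set ℝ}
    (hN : N ∈ 𝓝 t) : γ '' N ∈ @nhds X F.leafTopology (γ t) := by
  have hN' : ∀ᶠ s in 𝓝 t, s ∈ N ∧ γ s = e.symm (e (γ t) + (s - t) • horizontalUnit n) :=
    Filter.Eventually.and hN h.2
  have hc : Tendsto (fun s : ℝ => t + s) (𝓝 0) (𝓝 t) := by
    simpa using (by fun_prop : Continuous fun s : ℝ => t + s).tendsto 0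
  refine mem_of_superset (plaque_mem_nhds he h.1 (hc.eventually hN')) ?_
  rintro _ ⟨s, hs, rfl⟩
  refine ⟨t + s, hs.1, ?_⟩
  rw [hs.2, add_sub_cancel_left]

theorem IsAffineOn.isOpen_image (h : F.IsAffineOn γ I) (hJ : IsOpen J) (hJI : J ⊆ I) :
    @IsOpen X F.leafTopology (γ '' J) := by
  refine (@isOpen_iff_mem_nhds X F.leafTopology _).2 ?_
  rintro _ ⟨t, ht, rfl⟩
  obtain ⟨e, he, h⟩ := h t (hJI ht)
  exact h.image_mem_nhds he (hJ.mem_nhds ht)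

theorem IsAffineOn.continuousOn_leaf (h : F.IsAffineOn γ I) :
    ContinuousOn (F.toLeafSpace γ) I := fun t ht => by
  obtain ⟨e, he, h⟩ := h t ht
  exact (h.continuousAt_leaf he).continuousWithinAt

theorem leaf_eq_of_mem {p q : X} (h : q ∈ F.leaf p) : F.leaf q = F.leaf p :=
  (@connectedComponent_eq X F.leafTopology p q h).symm

theorem mem_leaf_self (p : X) : p ∈ F.leaf p := @mem_connectedComponent X F.leafTopology p

/-- Affine curves stay in a leaf. -/
theorem IsAffineOn.mem_leaf (h : F.IsAffineOn γ I) (hI : IsPreconnected I) {s t : ℝ} (hs : s ∈ I)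
    (ht : t ∈ I) : γ t ∈ F.leaf (γ s) :=
  IsPreconnected.subset_connectedComponent (α := F.LeafSpace)
    (hI.image _ h.continuousOn_leaf) ⟨s, hs, rfl⟩ ⟨t, ht, rfl⟩

/-- A leaf of a foliation with holomorphic charts is swept out by any maximal affine curve. -/
theorem IsMaximalAffine.image_eq_leaf [T2Space X]
    (hA : ∀ x : X, ∃ e ∈ F.holoCharts, x ∈ e.source)
    (h : IsMaximalAffine F e x γ I) : γ '' I = F.leaf x := by
  apply Subset.antisymm
  · rintro _ ⟨t, ht, rfl⟩
    rw [← h.apply_zero]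
    exact h.isAffineOn.mem_leaf h.ordConnected.isPreconnected h.zero_mem ht
  · have hopen : @IsOpen X F.leafTopology (γ '' I) := h.isAffineOn.isOpen_image h.isOpen Subset.rfl
    have hclosed : @IsClosed X F.leafTopology (γ '' I) := by
      refine (@isClosed_iff_frequently X F.leafTopology _).2 fun y hy => ?_
      obtain ⟨e', he', hy'⟩ := hA y
      obtain ⟨r, hr, hball⟩ := Metric.eventually_nhds_iff_ball.1
        ((tendsto_add_smul_horizontalUnit (e' y)).eventually
          (e'.open_target.eventually_mem (e'.map_source hy')))
      -- A short plaque around the limit point `y` meets the curve at time `t`, at signed distance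
      -- `u` from `y`. Inside the chart the curve can be followed until it hits `y`.
      obtain ⟨_, ⟨t, ht, rfl⟩, u, hu, hut⟩ := (hy.and_eventually
        (plaque_mem_nhds he' hy' (Metric.ball_mem_nhds 0 hr))).exists
      dsimp only at hut
      have hsrc : γ t ∈ e'.source := hut ▸ e'.map_target (hball u hu)
      have het : e' (γ t) = e' y + u • horizontalUnit n := by
        rw [← hut, e'.right_inv (hball u hu)]
      obtain ⟨e'', he'', hγ⟩ := h.isAffineOn t ht
      obtain ⟨c, hc⟩ := exists_rescale_affineAt he'' he' hγ hsrc
      have hval : ∀ s : ℝ, (c : ℝ)⁻¹ • (e'.rescale c (γ t) + (s - t) • horizontalUnit n) =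
          e' y + (u + (c : ℝ)⁻¹ * (s - t)) • horizontalUnit n := fun s => by
        rw [OpenPartialHomeomorph.rescale_apply, smul_add, smul_smul, smul_smul,
          inv_mul_cancel₀ c.ne_zero, one_smul, het, add_assoc, ← add_smul]
      have hcont : Continuous fun s : ℝ => u + (c : ℝ)⁻¹ * (s - t) := by fun_prop
      have hext := h.extend (rescale_mem_holoCharts he' c) ht hc
        (J := (fun s : ℝ => u + (c : ℝ)⁻¹ * (s - t)) ⁻¹' Metric.ball 0 r)
        (Metric.isOpen_ball.preimage hcont)
        (by
          refine Convex.ordConnected ?_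
          intro s₁ h₁ s₂ h₂ a b ha hb hab
          have := convex_ball (0 : ℝ) r h₁ h₂ ha hb hab
          simp only [mem_preimage]
          convert this using 1
          simp only [smul_eq_mul]
          linear_combination ((c : ℝ)⁻¹ * t - u) * hab)
        (by simpa using hu)
        (fun s hs => by
          rw [OpenPartialHomeomorph.mem_rescale_target, hval]
          exact hball _ hs)
      -- The curve has speed `c⁻¹` in `e'`, so it passes through `y` at time `t - c * u`.
      have hmem : t - c * u ∈ (fun s : ℝ => u + (c : ℝ)⁻¹ * (s - t)) ⁻¹' Metric.ball 0 r := by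
        have : u + (c : ℝ)⁻¹ * (t - c * u - t) = 0 := by
          have := inv_mul_cancel₀ c.ne_zero
          linear_combination (-u) * this
        simp only [mem_preimage, this, Metric.mem_ball_self hr]
      refine ⟨t - c * u, hext.1 hmem, ?_⟩
      rw [hext.2 _ hmem, OpenPartialHomeomorph.rescale_symm_apply, hval]
      have : u + (c : ℝ)⁻¹ * (t - c * u - t) = 0 := by
        have := inv_mul_cancel₀ c.ne_zero
        linear_combination (-u) * this
      rw [this, zero_smul, add_zero, e'.left_inv hy']
    exact IsClopen.connectedComponent_subset (α := F.LeafSpace) ⟨hclosed, hopen⟩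
      ⟨0, h.zero_mem, h.apply_zero⟩

/-- An affine curve in a noncompact leaf does not return to a point. -/
theorem IsAffineOn.injOn [T2Space X] (h : F.IsAffineOn γ I) (hI : I.OrdConnected) (hx : x ∈ γ '' I)
    (hnc : ¬ @IsCompact X F.leafTopology (F.leaf x)) : InjOn γ I := by
  suffices H : ∀ s ∈ I, ∀ s' ∈ I, s < s' → γ s ≠ γ s' by
    intro s hs s' hs' hss
    rcases lt_trichotomy s s' with h1 | h1 | h1
    · exact absurd hss (H s hs s' hs' h1)
    · exact h1
    · exact absurd hss.symm (H s' hs' s hs h1)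
  intro s hs s' hs' hlt heq
  obtain ⟨e, he, hγ⟩ := h s hs
  obtain ⟨e', he', hγ'⟩ := h s' hs'
  obtain ⟨c, hc⟩ := exists_rescale_affineAt he' he hγ' (heq ▸ hγ.1)
  -- The two branches through `γ s = γ s'` run in the same plaque with velocities in the constant
  -- ratio `c`, which need not be one.
  have hline : ∀ᶠ u in 𝓝 (0 : ℝ), γ (s' + c * u) = γ (s + u) := by
    have h1 : Tendsto (fun u : ℝ => s' + c * u) (𝓝 0) (𝓝 s') := by
      simpa using (by fun_prop : Continuous fun u : ℝ => s' + c * u).tendsto 0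
    have h2 : Tendsto (fun u : ℝ => s + u) (𝓝 0) (𝓝 s) := by
      simpa using (by fun_prop : Continuous fun u : ℝ => s + u).tendsto 0
    filter_upwards [h1.eventually hc.2, h2.eventually hγ.2] with u hu hu'
    rw [hu, hu', OpenPartialHomeomorph.rescale_symm_apply, OpenPartialHomeomorph.rescale_apply,
      smul_add, smul_smul, smul_smul, inv_mul_cancel₀ c.ne_zero, one_smul, heq]
    congr 3
    rw [add_sub_cancel_left, add_sub_cancel_left, ← mul_assoc, inv_mul_cancel₀ c.ne_zero, one_mul]
  have hIcc : Icc s s' ⊆ I := hI.out hs hs'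
  rcases lt_or_gt_of_ne c.ne_zero with hneg | hpos
  · -- the curve would turn back at the midpoint
    set d : ℝ := 1 - c with hd
    have hd0 : 0 < d := by linarith
    -- At `u₀` the two times `s + u` and `s' + c * u` coincide. By unique continuation the branches
    -- agree up to and near `u₀`, where distinct times then give equal points, against local
    -- injectivity.
    set u₀ : ℝ := (s' - s) / d with hu₀
    have hu₀0 : 0 < u₀ := div_pos (by linarith) hd0
    have hu₀d : u₀ * d = s' - s := div_mul_cancel₀ _ hd0.ne'
    have hw : (c : ℝ) * u₀ + s' = s + u₀ := by linear_combination -hu₀d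
    have hA1 : F.IsAffineOn (fun v => γ (c * v + s')) (Icc 0 u₀) :=
      h.comp_affine c s' fun u hu => hIcc ⟨by nlinarith [hu.1, hu.2], by nlinarith [hu.1]⟩
    have hA2 : F.IsAffineOn (fun v => γ (((1 : ℝˣ) : ℝ) * v + s)) (Icc 0 u₀) :=
      h.comp_affine 1 s fun u hu => hIcc
        ⟨by simpa using hu.1, by simp only [Units.val_one, one_mul]; nlinarith [hu.1, hu.2]⟩
    have hev := hA1.eventuallyEq hA2 isPreconnected_Icc ⟨le_rfl, hu₀0.le⟩
      (by
        filter_upwards [hline] with u hu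
        rw [Units.val_one, one_mul, add_comm _ s', add_comm _ s, hu]) (t := u₀) ⟨hu₀0.le, le_rfl⟩
    have hwI : s + u₀ ∈ I := hIcc ⟨by linarith, by nlinarith⟩
    obtain ⟨e₂, he₂, hγ₂⟩ := h _ hwI
    obtain ⟨N, hN, hinj⟩ := hγ₂.eventually_injective
    have h1 : Tendsto (fun u : ℝ => c * u + s') (𝓝 u₀) (𝓝 (s + u₀)) := by
      rw [← hw]; exact (by fun_prop : Continuous fun u : ℝ => c * u + s').tendsto u₀
    have h2 : Tendsto (fun u : ℝ => ((1 : ℝˣ) : ℝ) * u + s) (𝓝 u₀) (𝓝 (s + u₀)) := by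
      have := (by fun_prop : Continuous fun u : ℝ => ((1 : ℝˣ) : ℝ) * u + s).tendsto u₀
      rwa [Units.val_one, one_mul, add_comm] at this
    obtain ⟨u, ⟨hu1, hu2, hu3⟩, hu4⟩ := (((hev.and ((h1.eventually hN).and (h2.eventually hN))
      ).filter_mono nhdsWithin_le_nhds).and
      (self_mem_nhdsWithin : ∀ᶠ u in 𝓝[≠] u₀, u ∈ ({u₀}ᶜ : Set ℝ))).exists
    have h3 := hinj hu2 hu3 hu1
    rw [Units.val_one, one_mul] at h3
    refine hu4 ?_
    have : (u - u₀) * d = 0 := by linear_combination -h3 - hu₀d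
    rcases mul_eq_zero.1 this with h4 | h4
    · exact sub_eq_zero.1 h4
    · exact absurd h4 hd0.ne'
  · -- the arc from `s` to `s'` would be the whole leaf
    have hcomp : IsCompact (X := F.LeafSpace) (γ '' Icc s s') :=
      isCompact_Icc.image_of_continuousOn (f := F.toLeafSpace γ) (h.continuousOn_leaf.mono hIcc)
    have hclosed : IsClosed (X := F.LeafSpace) (γ '' Icc s s') := hcomp.isClosed
    -- Around the common endpoint, the arc covers the forward side by times just after `s` and the
    -- backward side by times just before `s'`, as `c` is positive.
    have hends : γ '' Icc s s' ∈ @nhds X F.leafTopology (γ s) := by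
      have h1 : ∀ᶠ u in 𝓝 (0 : ℝ), γ (s' + c * u) = γ (s + u) ∧ u < s' - s ∧ s - s' < c * u ∧
          γ (s + u) = e.symm (e (γ s) + u • horizontalUnit n) := by
        have h2 : Tendsto (fun u : ℝ => c * u) (𝓝 0) (𝓝 0) := by
          simpa using (by fun_prop : Continuous fun u : ℝ => (c : ℝ) * u).tendsto 0
        have h3 : Tendsto (fun u : ℝ => s + u) (𝓝 0) (𝓝 s) := by
          simpa using (by fun_prop : Continuous fun u : ℝ => s + u).tendsto 0
        filter_upwards [hline, gt_mem_nhds (sub_pos.2 hlt),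
          h2.eventually (lt_mem_nhds (sub_neg.2 hlt)), h3.eventually hγ.2] with u hu1 hu2 hu3 hu4
        exact ⟨hu1, hu2, hu3, by rw [hu4, add_sub_cancel_left]⟩
      refine mem_of_superset (plaque_mem_nhds he hγ.1 h1) ?_
      rintro _ ⟨u, ⟨hu1, hu2, hu3, hu4⟩, rfl⟩
      dsimp only
      rw [← hu4]
      rcases le_or_gt 0 u with hu | hu
      · exact ⟨s + u, ⟨by linarith, by linarith⟩, rfl⟩
      · exact ⟨s' + c * u, ⟨by linarith, by nlinarith⟩, hu1⟩
    have hopen : IsOpen (X := F.LeafSpace) (γ '' Icc s s') := by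
      refine isOpen_iff_mem_nhds.2 ?_
      rintro _ ⟨r, hr, rfl⟩
      rcases eq_or_ne r s with rfl | hrs
      · exact hends
      rcases eq_or_ne r s' with rfl | hrs'
      · exact heq ▸ hends
      obtain ⟨e₂, he₂, hγ₂⟩ := h _ (hIcc hr)
      exact hγ₂.image_mem_nhds he₂ (Icc_mem_nhds (lt_of_le_of_ne hr.1 hrs.symm)
        (lt_of_le_of_ne hr.2 hrs'))
    obtain ⟨r, hr, rfl⟩ := hx
    have hleaf : F.leaf (γ r) = F.leaf (γ s) :=
      leaf_eq_of_mem (h.mem_leaf hI.isPreconnected hs hr)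
    have hsub : F.leaf (γ s) ⊆ γ '' Icc s s' :=
      IsClopen.connectedComponent_subset (α := F.LeafSpace) ⟨hclosed, hopen⟩
        ⟨s, ⟨le_rfl, hlt.le⟩, rfl⟩
    have hsub' : γ '' Icc s s' ⊆ F.leaf (γ s) := by
      rintro _ ⟨v, hv, rfl⟩
      exact h.mem_leaf hI.isPreconnected hs (hIcc hv)
    refine hnc ?_
    rw [hleaf, hsub.antisymm hsub']
    exact hcomp

/-- Betweenness on an affine curve in a noncompact leaf. -/
theorem IsAffineOn.between [T2Space X] (h : F.IsAffineOn γ I) (hI : I.OrdConnected)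
    (hIo : IsOpen I) (himg : γ '' I = F.leaf x)
    (hnc : ¬ @IsCompact X F.leafTopology (F.leaf x)) {r s t : ℝ} (hr : r ∈ I)
    (ht : t ∈ I) (hrs : r ≤ s) (hst : s ≤ t) : F.Between (γ r) (γ s) (γ t) := by
  have hs : s ∈ I := hI.out hr ht ⟨hrs, hst⟩
  have hinj : InjOn γ I := h.injOn hI (himg ▸ mem_leaf_self x) hnc
  refine ⟨h.mem_leaf hI.isPreconnected hr ht, fun S hS hSc hrS htS => ?_⟩
  by_contra hsS
  have hleaf : F.leaf (γ r) = γ '' I := by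
    rw [himg]
    exact leaf_eq_of_mem (himg ▸ ⟨r, hr, rfl⟩)
  have hrs' : r < s := lt_of_le_of_ne hrs (by rintro rfl; exact hsS hrS)
  have hst' : s < t := lt_of_le_of_ne hst (by rintro rfl; exact hsS htS)
  -- Removing `γ s` leaves the images of the earlier and the later times. Both are open in the leaf
  -- and, by injectivity, disjoint, so a connected set avoiding `γ s` cannot meet both.
  obtain ⟨_, -, ⟨u, hu, rfl⟩, ⟨v, hv, huv⟩⟩ := IsConnected.isPreconnected (α := F.LeafSpace) hSc (γ '' (I ∩ Iio s))
    (γ '' (I ∩ Ioi s))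
    (h.isOpen_image (hIo.inter isOpen_Iio) inter_subset_left)
    (h.isOpen_image (hIo.inter isOpen_Ioi) inter_subset_left)
    (by
      intro y hy
      obtain ⟨v, hv, rfl⟩ := hleaf ▸ hS hy
      rcases lt_trichotomy v s with h1 | h1 | h1
      · exact Or.inl ⟨v, ⟨hv, h1⟩, rfl⟩
      · exact absurd (h1 ▸ hy) hsS
      · exact Or.inr ⟨v, ⟨hv, h1⟩, rfl⟩)
    ⟨γ r, hrS, r, ⟨hr, hrs'⟩, rfl⟩ ⟨γ t, htS, t, ⟨ht, hst'⟩, rfl⟩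
  have := hinj hv.1 hu.1 huv
  exact lt_irrefl s (hv.2.trans (this ▸ hu.2))

/-- Points between two points of an affine curve lie on the arc joining them. -/
theorem IsAffineOn.exists_of_between (h : F.IsAffineOn γ I) (hI : I.OrdConnected) {r t : ℝ}
    (hr : r ∈ I) (ht : t ∈ I) (hrt : r ≤ t) {b : X} (hb : F.Between (γ r) b (γ t)) :
    ∃ s ∈ Icc r t, γ s = b := by
  have hIcc := hI.out hr ht
  refine hb.2 (γ '' Icc r t) ?_ ?_ ⟨r, ⟨le_rfl, hrt⟩, rfl⟩ ⟨t, ⟨hrt, le_rfl⟩, rfl⟩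
  · rintro _ ⟨v, hv, rfl⟩
    exact h.mem_leaf hI.isPreconnected hr (hIcc hv)
  · exact (isConnected_Icc hrt).image (F.toLeafSpace γ) (h.continuousOn_leaf.mono hIcc)

end SmoothFoliation

/-! ### Biholomorphic motion along leaves, and part (b) -/

namespace SmoothFoliation

variable {n : ℕ} [NeZero n] {X : Type*} [TopologicalSpace X]
  [ChartedSpace (EuclideanSpace ℂ (Fin n)) X] {F : SmoothFoliation n X}
  {e e' : OpenPartialHomeomorph X (EuclideanSpace ℂ (Fin n))} {p : X}

/-- Near `p`, moving along the curves `γ x` from time `0` to time `t` is possible, and is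
biholomorphic at all intermediate times. -/
def FlowsTo (F : SmoothFoliation n X) (e : OpenPartialHomeomorph X (EuclideanSpace ℂ (Fin n)))
    (γ : X → ℝ → X) (I : X → Set ℝ) (p : X) (t : ℝ) : Prop :=
  ∃ U : Set X, IsOpen U ∧ p ∈ U ∧ U ⊆ e.source ∧ (∀ x ∈ U, t ∈ I x) ∧
    (∃ e' ∈ F.holoCharts, ∀ x ∈ U, AffineAt e' (γ x) t) ∧
    ∀ s ∈ Icc 0 t, ∃ k : OpenPartialHomeomorph X X, IsBiholo n k ∧ k.source = U ∧
      ∀ x ∈ U, k x = γ x s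

theorem flowsTo_zero {γ : X → ℝ → X} {I : X → Set ℝ} (he : e ∈ F.holoCharts)
    (hmax : ∀ x ∈ e.source, IsMaximalAffine F e x (γ x) (I x)) (hp : p ∈ e.source) :
    F.FlowsTo e γ I p 0 := by
  refine ⟨e.source, e.open_source, hp, Subset.rfl, fun x hx => (hmax x hx).zero_mem,
    ⟨e, he, fun x hx => (hmax x hx).affineAt_zero⟩, fun s hs => ?_⟩
  obtain rfl : s = 0 := le_antisymm hs.2 hs.1
  refine ⟨(OpenPartialHomeomorph.refl X).restr e.source, isBiholo_refl.restr _, ?_,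
    fun x hx => ((hmax x hx).apply_zero).symm⟩
  rw [OpenPartialHomeomorph.restr_source' _ _ e.open_source]
  simp

/-- Take a chart at `γ p t` in which the curve of `p` has unit speed. By rigidity the curves of all
points near `p` have unit speed there too, so passing from time `s` to any nearby later time is one
translation in that chart. -/
theorem flowsTo_congr [T2Space X] {γ : X → ℝ → X} {I : X → Set ℝ}
    (hmax : ∀ x ∈ e.source, IsMaximalAffine F e x (γ x) (I x)) (hp : p ∈ e.source) {t : ℝ}
    (ht : t ∈ I p) :
    ∃ r > 0, ∀ s ∈ Ioo (t - r) (t + r), ∀ s' ∈ Ioo (t - r) (t + r), 0 ≤ s →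
      F.FlowsTo e γ I p s → F.FlowsTo e γ I p s' := by
  obtain ⟨e₁, he₁, h₁⟩ := (hmax p hp).isAffineOn t ht
  obtain ⟨ρ, hρ, hball⟩ := Metric.eventually_nhds_iff_ball.1
    (e₁.open_target.eventually_mem (e₁.map_source h₁.1))
  obtain ⟨δ, hδ, hδball⟩ := Metric.eventually_nhds_iff_ball.1 (h₁.2.and h₁.eventually_chart)
  -- The starting point and the time each shift the chart value by less than `r`, and `2 * r` is
  -- less than `ρ`.
  set r := min δ (ρ / 4) with hr
  have hr0 : 0 < r := lt_min hδ (by linarith)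
  have hrδ : r ≤ δ := min_le_left _ _
  have hrρ : r ≤ ρ / 4 := min_le_right _ _
  have hJball : ∀ v ∈ Ioo (t - r) (t + r), v ∈ Metric.ball t δ := fun v hv => by
    rw [Real.ball_eq_Ioo]
    exact ⟨by linarith [hv.1], by linarith [hv.2]⟩
  refine ⟨r, hr0, ?_⟩
  rintro s hs s' hs' hs0 ⟨U, hU, hpU, hUe, hUI, ⟨e₂, he₂, h₂⟩, hk⟩
  have hes := (hδball s (hJball s hs)).2
  have h₁s : AffineAt e₁ (γ p) s := by
    refine ⟨hes.1, ?_⟩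
    filter_upwards [Ioo_mem_nhds hs.1 hs.2] with v hv
    rw [(hδball v (hJball v hv)).1, hes.2, add_assoc, ← add_smul]
    congr 3; ring
  -- The old chart `e₂` and the new chart `e₁` both give unit speed to the curve of `p`, so they
  -- have the same flow near `γ p s`.
  have hsame := eventually_sameFlow he₂ he₁ (h₂ p hpU) h₁s
    (Eventually.frequently (Eventually.of_forall fun _ => rfl)) rfl
  obtain ⟨k, hkb, hkU, hkγ⟩ := hk s ⟨hs0, le_rfl⟩
  have hkc : Tendsto k (𝓝 p) (𝓝 (γ p s)) := by
    have := k.continuousAt (hkU ▸ hpU : p ∈ k.source)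
    rwa [ContinuousAt, hkγ p hpU] at this
  have hnear : ∀ᶠ x in 𝓝 p, k x ∈ e₁.source ∧ SameFlow e₂ e₁ (k x) ∧
      e₁ (k x) ∈ Metric.ball (e₁ (γ p s)) r := by
    filter_upwards [hkc.eventually hsame, hkc.eventually
      ((e₁.continuousAt hes.1).eventually (Metric.ball_mem_nhds _ hr0))] with x hx hx'
    exact ⟨hx.2.1, hx.2.2, hx'⟩
  obtain ⟨V, hV, hVo, hpV⟩ := eventually_nhds_iff.1 hnear
  have hγV : ∀ x ∈ U ∩ V, γ x s ∈ e₁.source ∧ SameFlow e₂ e₁ (γ x s) ∧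
      e₁ (γ x s) ∈ Metric.ball (e₁ (γ p s)) r := fun x hx => by
    rw [← hkγ x hx.1]; exact hV x hx.2
  have htarget : ∀ x ∈ U ∩ V, ∀ v ∈ Ioo (t - r) (t + r),
      e₁ (γ x s) + (v - s) • horizontalUnit n ∈ e₁.target := by
    intro x hx v hv
    apply hball
    have h1 := (hγV x hx).2.2
    rw [mem_ball_iff_norm] at h1 ⊢
    have h2 : e₁ (γ x s) + (v - s) • horizontalUnit n - e₁ (γ p t) =
        (e₁ (γ x s) - e₁ (γ p s)) + (v - t) • horizontalUnit n := by
      rw [hes.2, sub_smul, sub_smul, sub_smul]; abel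
    have h3 : ‖(v - t) • horizontalUnit n‖ < r := by
      rw [norm_smul, norm_horizontalUnit, mul_one, Real.norm_eq_abs, abs_lt]
      exact ⟨by linarith [hv.1], by linarith [hv.2]⟩
    rw [h2]
    linarith [norm_add_le (e₁ (γ x s) - e₁ (γ p s)) ((v - t) • horizontalUnit n)]
  have hext : ∀ x ∈ U ∩ V, Ioo (t - r) (t + r) ⊆ I x ∧ ∀ v ∈ Ioo (t - r) (t + r),
      γ x v = e₁.symm (e₁ (γ x s) + (v - s) • horizontalUnit n) := fun x hx =>
    (hmax x (hUe hx.1)).extend he₁ (hUI x hx.1)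
      ((h₂ x hx.1).of_sameFlow (hγV x hx).1 (hγV x hx).2.1) isOpen_Ioo ordConnected_Ioo hs
      (htarget x hx)
  refine ⟨U ∩ V, hU.inter hVo, ⟨hpU, hpV⟩, inter_subset_left.trans hUe,
    fun x hx => (hext x hx).1 hs', ⟨e₁, he₁, fun x hx => ?_⟩, fun w hw => ?_⟩
  · refine (affineAt_line (htarget x hx s' hs')).congr ?_
    filter_upwards [Ioo_mem_nhds hs'.1 hs'.2] with v hv using (hext x hx).2 v hv
  · rcases le_or_gt w s with hws | hws
    · obtain ⟨k', hkb', hkU', hkγ'⟩ := hk w ⟨hw.1, hws⟩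
      refine ⟨k'.restr V, hkb'.restr V, ?_, fun x hx => hkγ' x hx.1⟩
      rw [k'.restr_source' _ hVo, hkU']
    · have hwJ : w ∈ Ioo (t - r) (t + r) := ⟨hs.1.trans hws, hw.2.trans_lt hs'.2⟩
      -- Beyond time `s`, follow the old motion to time `s` and then translate by `w - s` in `e₁`.
      refine ⟨(k.restr V).trans (e₁.trans ((translation ((w - s) • horizontalUnit n)).trans
        e₁.symm)), (hkb.restr V).trans (he₁.2.trans ((isBiholo_translation _).trans he₁.2.symm)),
        ?_, fun x hx => ?_⟩
      · ext x
        rw [OpenPartialHomeomorph.trans_source, k.restr_source' _ hVo, hkU]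
        refine ⟨fun hx => hx.1, fun hx => ⟨hx, ?_⟩⟩
        have hx1 : (k.restr V) x = γ x s := hkγ x hx.1
        rw [mem_preimage, hx1, OpenPartialHomeomorph.trans_source,
          OpenPartialHomeomorph.trans_source]
        exact ⟨(hγV x hx).1, mem_univ _, htarget x hx w hwJ⟩
      · have hx1 : (k.restr V) x = γ x s := hkγ x hx.1
        rw [OpenPartialHomeomorph.coe_trans, Function.comp_apply, hx1, (hext x hx).2 w hwJ]
        rfl

/-- The property passes between nearby times in both directions and holds at time zero, so it
spreads over the connected interval `[0, t]`. -/
theorem flowsTo_of_mem [T2Space X] {γ : X → ℝ → X} {I : X → Set ℝ} (he : e ∈ F.holoCharts)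
    (hmax : ∀ x ∈ e.source, IsMaximalAffine F e x (γ x) (I x)) (hp : p ∈ e.source) {t : ℝ}
    (ht : t ∈ I p) (ht0 : 0 ≤ t) : F.FlowsTo e γ I p t := by
  have hsub : Icc 0 t ⊆ I p := (hmax p hp).ordConnected.out (hmax p hp).zero_mem ht
  refine isPreconnected_Icc.induction₂' (fun s s' => F.FlowsTo e γ I p s → F.FlowsTo e γ I p s')
    (fun s hs => ?_) (fun s s' s'' _ _ _ h h' hs => h' (h hs)) ⟨le_rfl, ht0⟩ ⟨ht0, le_rfl⟩
    (flowsTo_zero he hmax hp)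
  obtain ⟨r, hr, h⟩ := flowsTo_congr hmax hp (hsub hs)
  have hsr : s ∈ Ioo (s - r) (s + r) := ⟨by linarith, by linarith⟩
  filter_upwards [self_mem_nhdsWithin, mem_nhdsWithin_of_mem_nhds (Ioo_mem_nhds hsr.1 hsr.2)]
    with s' hs' hs'r
  exact ⟨h s hsr s' hs'r hs.1, h s' hs'r s hsr hs'.1⟩

/-- Each point of a leaf is reached from a given one by an affine curve in positive time, for a
suitable initial velocity. -/
theorem exists_isMaximalAffine_apply_eq [T2Space X]
    (hA : ∀ x : X, ∃ e ∈ F.holoCharts, x ∈ e.source) {q : X} (hq : q ∈ F.leaf p) :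
    ∃ e ∈ F.holoCharts, p ∈ e.source ∧ ∃ γ I, IsMaximalAffine F e p γ I ∧
      ∃ t ∈ I, 0 ≤ t ∧ γ t = q := by
  obtain ⟨e, he, hp⟩ := hA p
  obtain ⟨γ, I, hγ⟩ := exists_isMaximalAffine he hp
  rw [← hγ.image_eq_leaf hA] at hq
  obtain ⟨t, ht, rfl⟩ := hq
  rcases le_or_gt 0 t with ht0 | ht0
  · exact ⟨e, he, hp, γ, I, hγ, t, ht, ht0, rfl⟩
  · have he' : e.rescale (-1)⁻¹ ∈ F.holoCharts := rescale_mem_holoCharts he _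
    obtain ⟨σ, J, hσ⟩ := exists_isMaximalAffine he' (x := p) hp
    have hneg : ∀ u : ℝ, (((-1 : ℝˣ) : ℝ) * u + 0) = -u := fun u => by simp
    have hmax := hσ.maximal (Neg.neg ⁻¹' I) (fun v => γ (((-1 : ℝˣ) : ℝ) * v + 0))
      (hγ.isOpen.preimage continuous_neg)
      ⟨fun a ha b hb c hc => hγ.ordConnected.out hb ha ⟨neg_le_neg hc.2, neg_le_neg hc.1⟩⟩
      (by simpa using hγ.zero_mem)
      (hγ.isAffineOn.comp_affine (-1) 0 fun u hu => by rw [hneg]; exact hu)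
      (by simpa using hγ.apply_zero) (hγ.affineAt_zero.comp_affine (by simp))
    have hmem : -t ∈ Neg.neg ⁻¹' I := by simpa using ht
    refine ⟨_, he', hp, σ, J, hσ, -t, hmax.1 hmem, by linarith, ?_⟩
    rw [← hmax.2 hmem]
    simp

/-- The time `t` depends only on `p` and `q`, so `h` is a time-`t` map and its intermediate maps are
the time-`s` maps, with one `s` for all starting points. -/
theorem IsQuasiholomorphic.of_hasHolomorphicAtlas [T2Space X] (hnc : F.HasNoCompactLeaves)
    (h : F.HasHolomorphicAtlas) : F.IsQuasiholomorphic := by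
  obtain ⟨A, hAF, hAb, hAc⟩ := h
  have hA : ∀ x : X, ∃ e ∈ F.holoCharts, x ∈ e.source := fun x => by
    obtain ⟨e, he, hx⟩ := hAc x
    exact ⟨e, ⟨hAF he, hAb e he⟩, hx⟩
  refine ⟨hnc, fun p q hq => ?_⟩
  obtain ⟨e, he, hp, γ₀, I₀, hγ₀, t, ht₀, ht0, hγt₀⟩ := exists_isMaximalAffine_apply_eq hA hq
  have hex : ∀ x, ∃ γ : ℝ → X, ∃ I, x ∈ e.source → IsMaximalAffine F e x γ I := fun x => by
    by_cases hx : x ∈ e.source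
    · obtain ⟨γ, I, h⟩ := exists_isMaximalAffine he hx
      exact ⟨γ, I, fun _ => h⟩
    · exact ⟨γ₀, I₀, fun h => absurd h hx⟩
  choose γ I hγ using hex
  -- The curve chosen for `p` may differ from `γ₀`; maximality makes it extend `γ₀`.
  obtain ⟨hIp, hγp⟩ := (hγ p hp).maximal I₀ γ₀ hγ₀.isOpen hγ₀.ordConnected hγ₀.zero_mem
    hγ₀.isAffineOn hγ₀.apply_zero hγ₀.affineAt_zero
  have ht : t ∈ I p := hIp ht₀
  have hγt : γ p t = q := (hγp ht₀).symm.trans hγt₀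
  obtain ⟨U, hU, hpU, hUe, hUI, -, hk⟩ := flowsTo_of_mem he hγ hp ht ht0
  have hbetween : ∀ x ∈ U, ∀ s ∈ Icc 0 t, F.Between x (γ x s) (γ x t) := by
    intro x hx s hs
    have hx' := hγ x (hUe hx)
    have := hx'.isAffineOn.between hx'.ordConnected hx'.isOpen (hx'.image_eq_leaf hA) (hnc x)
      hx'.zero_mem (hUI x hx) hs.1 hs.2
    rwa [hx'.apply_zero] at this
  obtain ⟨h, hb, hhU, hhγ⟩ := hk t ⟨ht0, le_rfl⟩
  refine ⟨h, hb, hhU ▸ hpU, (hhγ p hpU).trans hγt, fun x hx => ?_, fun a ha b hab => ?_⟩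
  · rw [hhU] at hx
    rw [hhγ x hx]
    exact (hbetween x hx t ⟨ht0, le_rfl⟩).1
  · rw [hhU] at ha
    have ha' := hγ a (hUe ha)
    rw [hhγ a ha] at hab
    obtain ⟨s, hs, rfl⟩ := ha'.isAffineOn.exists_of_between ha'.ordConnected ha'.zero_mem
      (hUI a ha) ht0 (by rwa [ha'.apply_zero])
    obtain ⟨k, hkb, hkU, hkγ⟩ := hk s hs
    refine ⟨k, hkb, hkU.trans hhU.symm, hkγ a ha, fun x hx => ?_⟩
    rw [hkU] at hx
    rw [hkγ x hx, hhγ x hx]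
    exact hbetween x hx s hs

end SmoothFoliation

/-! ### Composition with an analytic map, as an analytic map on paths -/

section Superposition

variable {E : Type*} [NormedAddCommGroup E] [NormedSpace ℂ E] {K : Type*} [TopologicalSpace K]
  [CompactSpace K]

/-- A continuous multilinear map acting pointwise on continuous functions. -/
noncomputable def ContinuousMultilinearMap.pointwise {k : ℕ} (p : E [×k]→L[ℂ] E) :
    C(K, E) [×k]→L[ℂ] C(K, E) :=
  MultilinearMap.mkContinuous
    { toFun := fun m => ⟨fun s => p fun i => m i s, by fun_prop⟩
      map_update_add' := fun m i x y => by
        ext s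
        have h : ∀ z : C(K, E), (fun j => Function.update m i z j s) =
            Function.update (fun j => m j s) i (z s) := fun z => by
          ext j; by_cases hj : j = i
          · subst hj; simp
          · simp [hj]
        simp [h]
      map_update_smul' := fun m i c x => by
        ext s
        have h : ∀ z : C(K, E), (fun j => Function.update m i z j s) =
            Function.update (fun j => m j s) i (z s) := fun z => by
          ext j; by_cases hj : j = i
          · subst hj; simp
          · simp [hj]
        simp [h] }
    ‖p‖ fun m => by
      refine (ContinuousMap.norm_le _ (by positivity)).2 fun s => ?_
      refine (p.le_opNorm _).trans ?_
      gcongr with i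
      exact (m i).norm_coe_le_norm s

theorem ContinuousMultilinearMap.norm_pointwise_le {k : ℕ} (p : E [×k]→L[ℂ] E) :
    ‖p.pointwise (K := K)‖ ≤ ‖p‖ :=
  MultilinearMap.mkContinuous_norm_le _ (norm_nonneg _) _

/-- The superposition operator of an analytic map is analytic on continuous functions. -/
theorem AnalyticAt.exists_superposition [CompleteSpace E] {V : E → E} {x₀ : E}
    (hV : AnalyticAt ℂ V x₀) :
    ∃ N : C(K, E) → C(K, E), ∃ r > 0, AnalyticAt ℂ N (ContinuousMap.const K x₀) ∧
      ∀ γ : C(K, E), ‖γ - ContinuousMap.const K x₀‖ < r → ∀ s, N γ s = V (γ s) := by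
  obtain ⟨p, ρ, hp⟩ := hV
  set P : FormalMultilinearSeries ℂ C(K, E) C(K, E) := fun k => (p k).pointwise
  -- Acting pointwise does not increase the norms of the coefficients, so the series on paths
  -- converges at least as far.
  have hrad : p.radius ≤ P.radius :=
    FormalMultilinearSeries.radius_le_of_le fun k => (p k).norm_pointwise_le
  have hρ : 0 < P.radius := hp.r_pos.trans_le (hp.r_le.trans hrad)
  have hsum := P.hasFPowerSeriesOnBall hρ
  obtain ⟨r, hr0, hrρ⟩ := ENNReal.lt_iff_exists_nnreal_btwn.1 hp.r_pos
  refine ⟨fun γ => P.sum (γ - ContinuousMap.const K x₀), r, by exact_mod_cast hr0, ?_, ?_⟩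
  · have h0 : AnalyticAt ℂ P.sum (ContinuousMap.const K x₀ - ContinuousMap.const K x₀) := by
      rw [sub_self]; exact hsum.analyticAt
    exact h0.comp (f := fun γ => γ - ContinuousMap.const K x₀) (analyticAt_id.sub analyticAt_const)
  · intro γ hγ s
    set η := γ - ContinuousMap.const K x₀ with hη
    have hη' : ‖η‖ₑ < r := by
      rw [enorm_eq_nnnorm]
      exact_mod_cast hγ
    have h1 : HasSum (fun k => P k fun _ => η) (P.sum η) := by
      refine P.hasSum ?_
      rw [Metric.mem_eball, edist_zero_right]
      exact hη'.trans (hrρ.trans_le (hp.r_le.trans hrad))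
    have h2 : HasSum (fun k => p k fun _ => η s) (P.sum η s) :=
      (ContinuousMap.evalCLM ℂ s).hasSum h1
    have h3 : HasSum (fun k => p k fun _ => η s) (V (x₀ + η s)) := by
      refine hp.hasSum ?_
      rw [Metric.mem_eball, edist_zero_right]
      refine lt_of_le_of_lt ?_ (hη'.trans hrρ)
      rw [enorm_eq_nnnorm, enorm_eq_nnnorm]
      exact_mod_cast η.norm_coe_le_norm s
    rw [h2.unique h3]
    simp [hη]

end Superposition

/-! ### The flow equation, solved by the inverse function theorem -/

section FlowEquation

open unitInterval

variable {E : Type*} [NormedAddCommGroup E] [NormedSpace ℂ E]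

/-- The integral operator `h ↦ (s ↦ s • ∫ h (s * u) du)`, that is, the primitive vanishing at `0`,
on continuous functions on the unit interval. -/
noncomputable def primitiveCLM (E : Type*) [NormedAddCommGroup E] [NormedSpace ℂ E] :
    C(I, E) →L[ℂ] C(I, E) :=
  LinearMap.mkContinuous
    { toFun := fun h => ⟨fun s => (s : ℂ) • ∫ u : I, h (s * u), by
        have h1 : Continuous fun s : I => ∫ u : I in univ, h (s * u) :=
          continuous_parametric_integral_of_continuous (f := fun s u : I => h (s * u))
            (by fun_prop) isCompact_univ
        simp only [MeasureTheory.setIntegral_univ] at h1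
        fun_prop⟩
      map_add' := fun h k => by
        ext s
        have hi : ∀ f : C(I, E), MeasureTheory.Integrable fun u : I => f (s * u) := fun f =>
          (by fun_prop : Continuous fun u : I => f (s * u)).integrable_of_hasCompactSupport
            (HasCompactSupport.of_compactSpace _)
        simp [MeasureTheory.integral_add (hi h) (hi k)]
      map_smul' := fun c h => by
        ext s
        simp [MeasureTheory.integral_smul, smul_comm c] }
    1 fun h => by
      refine (ContinuousMap.norm_le _ (by positivity)).2 fun s => ?_
      have h1 : ‖∫ u : I, h (s * u)‖ ≤ ‖h‖ := by
        simpa using MeasureTheory.norm_integral_le_of_norm_le_const (μ := (MeasureTheory.volume : MeasureTheory.Measure I))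
          (Eventually.of_forall fun u : I => h.norm_coe_le_norm (s * u))
      have h2 : ‖((s : ℝ) : ℂ)‖ ≤ 1 := by
        rw [Complex.norm_real, Real.norm_eq_abs, abs_of_nonneg s.2.1]; exact s.2.2
      change ‖((s : ℝ) : ℂ) • ∫ u : I, h (s * u)‖ ≤ 1 * ‖h‖
      rw [norm_smul]
      exact mul_le_mul h2 h1 (norm_nonneg _) zero_le_one

theorem primitiveCLM_apply (h : C(I, E)) (s : I) :
    primitiveCLM E h s = (s : ℂ) • ∫ u : I, h (s * u) := rfl

/-- Constant functions, as a continuous linear map. -/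
noncomputable def constCLM (E : Type*) [NormedAddCommGroup E] [NormedSpace ℂ E] :
    E →L[ℂ] C(I, E) :=
  LinearMap.mkContinuous
    { toFun := fun x => ContinuousMap.const I x
      map_add' := fun _ _ => rfl
      map_smul' := fun _ _ => rfl } 1 fun x => by
      rw [one_mul]
      exact (ContinuousMap.norm_le _ (norm_nonneg _)).2 fun s => le_rfl

theorem constCLM_apply (x : E) : constCLM E x = ContinuousMap.const I x := rfl

/-- The shear `(t, x, γ) ↦ (t, x, γ - t c - const x)`. -/
noncomputable def flowShear (c : C(I, E)) : (ℂ × E × C(I, E)) ≃L[ℂ] (ℂ × E × C(I, E)) :=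
  ContinuousLinearEquiv.equivOfInverse
    ((ContinuousLinearMap.fst ℂ ℂ (E × C(I, E))).prod
      (((ContinuousLinearMap.fst ℂ E C(I, E)).comp
        (ContinuousLinearMap.snd ℂ ℂ (E × C(I, E)))).prod
      ((ContinuousLinearMap.snd ℂ E C(I, E)).comp (ContinuousLinearMap.snd ℂ ℂ (E × C(I, E))) -
        (constCLM E).comp ((ContinuousLinearMap.fst ℂ E C(I, E)).comp
          (ContinuousLinearMap.snd ℂ ℂ (E × C(I, E)))) -
        (ContinuousLinearMap.fst ℂ ℂ (E × C(I, E))).smulRight c)))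
    ((ContinuousLinearMap.fst ℂ ℂ (E × C(I, E))).prod
      (((ContinuousLinearMap.fst ℂ E C(I, E)).comp
        (ContinuousLinearMap.snd ℂ ℂ (E × C(I, E)))).prod
      ((ContinuousLinearMap.snd ℂ E C(I, E)).comp (ContinuousLinearMap.snd ℂ ℂ (E × C(I, E))) +
        (constCLM E).comp ((ContinuousLinearMap.fst ℂ E C(I, E)).comp
          (ContinuousLinearMap.snd ℂ ℂ (E × C(I, E)))) +
        (ContinuousLinearMap.fst ℂ ℂ (E × C(I, E))).smulRight c)))
    (fun v => by
      refine Prod.ext rfl (Prod.ext rfl ?_)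
      simp only [ContinuousLinearMap.prod_apply, add_apply,
        sub_apply, ContinuousLinearMap.comp_apply,
        ContinuousLinearMap.smulRight_apply, ContinuousLinearMap.coe_fst',
        ContinuousLinearMap.coe_snd']
      abel)
    (fun v => by
      refine Prod.ext rfl (Prod.ext rfl ?_)
      simp only [ContinuousLinearMap.prod_apply, add_apply,
        sub_apply, ContinuousLinearMap.comp_apply,
        ContinuousLinearMap.smulRight_apply, ContinuousLinearMap.coe_fst',
        ContinuousLinearMap.coe_snd']
      abel)

theorem flowShear_apply (c : C(I, E)) (v : ℂ × E × C(I, E)) :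
    flowShear c v = (v.1, v.2.1, v.2.2 - constCLM E v.2.1 - v.1 • c) := rfl

/-- The integral equation of the flow of an analytic vector field has an analytic solution. -/
theorem exists_analyticAt_integral_equation [CompleteSpace E] {V : E → E} {x₀ : E}
    (hV : AnalyticAt ℂ V x₀) :
    ∃ φ : ℂ × E → E, AnalyticAt ℂ φ (0, x₀) ∧ ∀ᶠ y in 𝓝 ((0 : ℂ), x₀),
      φ y = y.2 + y.1 • ∫ u : I, V (φ ((u : ℂ) * y.1, y.2)) := by
  obtain ⟨N, r, hr, hN, hNV⟩ := hV.exists_superposition (K := I)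
  -- The third component vanishes exactly when the path solves the integral equation with time
  -- factor `v.1` and initial point `v.2.1`. Keeping these parameters as components lets the inverse
  -- function theorem act as an implicit one.
  set Φ : ℂ × E × C(I, E) → ℂ × E × C(I, E) := fun v =>
    (v.1, v.2.1, v.2.2 - constCLM E v.2.1 - v.1 • primitiveCLM E (N v.2.2)) with hΦ
  set a : ℂ × E × C(I, E) := (0, x₀, ContinuousMap.const I x₀) with ha
  have hΦa : Φ a = (0, x₀, 0) := by
    simp [hΦ, ha, constCLM_apply]
  have hJ : AnalyticAt ℂ (fun v : ℂ × E × C(I, E) => primitiveCLM E (N v.2.2)) a := by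
    have h1 : AnalyticAt ℂ (fun v : ℂ × E × C(I, E) => v.2.2) a :=
      analyticAt_snd.comp (f := fun v : ℂ × E × C(I, E) => v.2) analyticAt_snd
    have h2 : AnalyticAt ℂ (fun v : ℂ × E × C(I, E) => N v.2.2) a :=
      AnalyticAt.comp (f := fun v : ℂ × E × C(I, E) => v.2.2) hN h1
    exact ((primitiveCLM E).analyticAt _).comp h2
  have hΦan : AnalyticAt ℂ Φ a := by
    have h1 : AnalyticAt ℂ (fun v : ℂ × E × C(I, E) => v.2.2) a :=
      analyticAt_snd.comp (f := fun v : ℂ × E × C(I, E) => v.2) analyticAt_snd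
    have h2 : AnalyticAt ℂ (fun v : ℂ × E × C(I, E) => v.2.1) a :=
      analyticAt_fst.comp (f := fun v : ℂ × E × C(I, E) => v.2) analyticAt_snd
    exact analyticAt_fst.prod (h2.prod ((h1.sub (((constCLM E).analyticAt _).comp h2)).sub
      (analyticAt_fst.smul hJ)))
  set c := primitiveCLM E (N (ContinuousMap.const I x₀)) with hc
  -- Since `a` has time zero, the nonlinear term contributes only in the time direction. The
  -- derivative is thus a shear, invertible without any smallness assumption.
  have hder : HasFDerivAt Φ (flowShear c : (ℂ × E × C(I, E)) →L[ℂ] (ℂ × E × C(I, E))) a := by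
    have hs : HasFDerivAt (fun v : ℂ × E × C(I, E) => v.1 • primitiveCLM E (N v.2.2))
        ((ContinuousLinearMap.fst ℂ ℂ (E × C(I, E))).smulRight c) a := by
      have := (hasFDerivAt_fst (𝕜 := ℂ) (p := a)).fun_smul hJ.differentiableAt.hasFDerivAt
      refine this.congr_fderiv ?_
      simp [ha, hc]
    have h3 := ((flowShear c).hasFDerivAt (x := a)).add
      ((hasFDerivAt_const (0 : ℂ) a).prodMk ((hasFDerivAt_const (0 : E) a).prodMk
        (((ContinuousLinearMap.fst ℂ ℂ (E × C(I, E))).smulRight c).hasFDerivAt.sub hs)))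
    refine (h3.congr_fderiv ?_).congr_of_eventuallyEq (Eventually.of_forall fun v => ?_)
    · ext v <;> simp
    · refine Prod.ext ?_ (Prod.ext ?_ ?_)
      · simp [hΦ, flowShear_apply]
      · simp [hΦ, flowShear_apply]
      · simp [hΦ, flowShear_apply]
  have hcd : ContDiffAt ℂ ω Φ a := hΦan.contDiffAt
  have hω : (ω : WithTop ℕ∞) ≠ 0 := by simp
  set G := hcd.localInverse hder hω
  have hGan : AnalyticAt ℂ G (0, x₀, 0) := by
    have := (hcd.to_localInverse hder hω).analyticAt
    rwa [hΦa] at this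
  have hGa : G (0, x₀, 0) = a := by
    have := hcd.localInverse_apply_image hder hω
    rwa [hΦa] at this
  have hleft : ∀ᶠ v in 𝓝 a, G (Φ v) = v :=
    (hcd.hasStrictFDerivAt' hder hω).eventually_left_inverse
  have hright : ∀ᶠ y in 𝓝 ((0 : ℂ), x₀, (0 : C(I, E))), Φ (G y) = y := by
    have := (hcd.hasStrictFDerivAt' hder hω).eventually_right_inverse
    rwa [hΦa] at this
  set ι : ℂ × E → ℂ × E × C(I, E) := fun y => (y.1, y.2, 0) with hι
  have hιan : AnalyticAt ℂ ι (0, x₀) := analyticAt_fst.prod (analyticAt_snd.prod analyticAt_const)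
  have hGι : AnalyticAt ℂ (fun y => G (ι y)) (0, x₀) := AnalyticAt.comp (f := ι) hGan hιan
  set Γ : ℂ × E → C(I, E) := fun y => (G (ι y)).2.2 with hΓ
  have hΓan : AnalyticAt ℂ Γ (0, x₀) :=
    (analyticAt_snd.comp analyticAt_snd).comp (f := fun y => G (ι y)) hGι
  have hGcont : Tendsto (fun y => G (ι y)) (𝓝 (0, x₀)) (𝓝 a) := by
    have := hGι.continuousAt.tendsto
    rwa [show G (ι (0, x₀)) = a from hGa] at this
  obtain ⟨ε, hε, hball⟩ := Metric.eventually_nhds_iff_ball.1 hleft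
  have hιcont : Tendsto ι (𝓝 (0, x₀)) (𝓝 (0, x₀, 0)) := hιan.continuousAt.tendsto
  refine ⟨fun y => Γ y 1, ((ContinuousMap.evalCLM ℂ (1 : I) : C(I, E) →L[ℂ] E).analyticAt _).comp hΓan, ?_⟩
  have hsmall : ∀ᶠ y in 𝓝 ((0 : ℂ), x₀), ‖Γ y - ContinuousMap.const I x₀‖ < r := by
    have h1 : Tendsto Γ (𝓝 (0, x₀)) (𝓝 (ContinuousMap.const I x₀)) :=
      ((continuous_snd.comp continuous_snd).tendsto a).comp hGcont
    have := h1.eventually (Metric.ball_mem_nhds _ hr)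
    exact this.mono fun y hy => mem_ball_iff_norm.1 hy
  filter_upwards [hsmall, hιcont.eventually hright,
    hGcont.eventually (Metric.ball_mem_nhds a hε)] with y hy1 hy2 hy3
  have hΦy1 : (G (ι y)).1 = y.1 := congrArg Prod.fst hy2
  have hΦy2 : (G (ι y)).2.1 = y.2 := congrArg (fun v => v.2.1) hy2
  have hΦy3 : Γ y - constCLM E y.2 - y.1 • primitiveCLM E (N (Γ y)) = 0 := by
    have := congrArg (fun v => v.2.2) hy2
    simp only [hΦ, hΦy1, hΦy2] at this
    exact this
  have heq : ∀ s : I, Γ y s = y.2 + (y.1 * s) • ∫ u : I, V (Γ y (s * u)) := by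
    intro s
    have h1 := congrArg (fun f : C(I, E) => f s) hΦy3
    have h2 : ∀ u : I, N (Γ y) (s * u) = V (Γ y (s * u)) := fun u => hNV _ hy1 _
    simp only [ContinuousMap.sub_apply, ContinuousMap.smul_apply, primitiveCLM_apply, h2,
      constCLM_apply, ContinuousMap.const_apply, ContinuousMap.zero_apply, smul_smul] at h1
    rw [sub_sub, sub_eq_zero] at h1
    exact h1
  -- rescaling time in a solution gives the solution for the rescaled parameter
  have hscale : ∀ s : I, Γ ((s : ℂ) * y.1, y.2) 1 = Γ y s := by
    intro s
    set R : C(I, E) := (Γ y).comp ⟨fun u => s * u, by fun_prop⟩ with hR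
    have hRnorm : ‖R - ContinuousMap.const I x₀‖ ≤ ‖Γ y - ContinuousMap.const I x₀‖ :=
      (ContinuousMap.norm_le _ (norm_nonneg _)).2 fun u =>
        (Γ y - ContinuousMap.const I x₀).norm_coe_le_norm (s * u)
    set v : ℂ × E × C(I, E) := ((s : ℂ) * y.1, y.2, R) with hv
    have hs1 : ‖((s : ℝ) : ℂ)‖ ≤ 1 := by
      rw [Complex.norm_real, Real.norm_eq_abs, abs_of_nonneg s.2.1]; exact s.2.2
    -- Slowing down keeps the time and the path as close to `a` as before, so `G` still inverts `Φ`
    -- at `v`: this is the uniqueness that identifies the slowed path.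
    have hvball : v ∈ Metric.ball a ε := by
      refine mem_ball_iff_norm.2 (lt_of_le_of_lt ?_ (mem_ball_iff_norm.1 hy3))
      rw [Prod.norm_def, Prod.norm_def]
      simp only [Prod.fst_sub, Prod.snd_sub, hv, ha, Prod.norm_def, sub_zero, hΦy1, hΦy2]
      refine max_le_max ?_ (max_le_max le_rfl hRnorm)
      rw [norm_mul]
      exact mul_le_of_le_one_left (norm_nonneg _) hs1
    have hΦv : Φ v = ι ((s : ℂ) * y.1, y.2) := by
      refine Prod.ext rfl (Prod.ext rfl ?_)
      ext u
      have h2 : ∀ w : I, N R (u * w) = V (Γ y (s * (u * w))) := fun w =>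
        hNV _ (hRnorm.trans_lt hy1) _
      have h3 := heq (s * u)
      simp only [hΦ, hv, hι, ContinuousMap.sub_apply, ContinuousMap.smul_apply,
        primitiveCLM_apply, h2, constCLM_apply, ContinuousMap.const_apply,
        ContinuousMap.zero_apply, smul_smul]
      rw [sub_sub, sub_eq_zero]
      change Γ y (s * u) = _
      rw [h3]
      simp only [mul_assoc]
      congr 2
      simp; ring
    have h4 : G (ι ((s : ℂ) * y.1, y.2)) = v := by rw [← hΦv]; exact hball v hvball
    change (G (ι ((s : ℂ) * y.1, y.2))).2.2 1 = _
    rw [h4]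
    simp [hv, hR]
  have h5 := heq 1
  simp only [one_mul, Icc.coe_one, Complex.ofReal_one, mul_one] at h5
  simp only [hscale]
  exact h5

end FlowEquation

/-! ### Complex-time flow and straightening of a holomorphic field -/

section FlowBox

open unitInterval

theorem unitInterval.integral_eq_intervalIntegral {E : Type*} [NormedAddCommGroup E]
    [NormedSpace ℝ E] (g : ℝ → E) : ∫ u : I, g u = ∫ u in (0 : ℝ)..1, g u := by
  rw [intervalIntegral.integral_of_le zero_le_one, ← MeasureTheory.integral_Icc_eq_integral_Ioc]
  exact unitInterval.measurePreserving_coe.integral_comp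
    (MeasurableEmbedding.subtype_coe measurableSet_Icc) g

/-- An analytic vector field has an analytic local flow in complex time. -/
theorem AnalyticAt.exists_flow {E : Type*} [NormedAddCommGroup E] [NormedSpace ℂ E]
    [CompleteSpace E] {V : E → E} {x₀ : E} (hV : AnalyticAt ℂ V x₀) :
    ∃ φ : ℂ × E → E, AnalyticAt ℂ φ (0, x₀) ∧ (∀ᶠ x in 𝓝 x₀, φ (0, x) = x) ∧
      ∀ᶠ y in 𝓝 ((0 : ℂ), x₀), HasDerivAt (fun t => φ (t, y.2)) (V (φ y)) y.1 := by
  obtain ⟨φ, hφ, heq⟩ := exists_analyticAt_integral_equation hV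
  have hzero : ∀ᶠ x in 𝓝 x₀, φ (0, x) = x := by
    have h1 : Tendsto (fun x : E => ((0 : ℂ), x)) (𝓝 x₀) (𝓝 (0, x₀)) :=
      (by fun_prop : Continuous fun x : E => ((0 : ℂ), x)).tendsto x₀
    filter_upwards [h1.eventually heq] with x hx
    simpa using hx
  refine ⟨φ, hφ, hzero, ?_⟩
  have hV' : ∀ᶠ y in 𝓝 ((0 : ℂ), x₀), AnalyticAt ℂ V (φ y) := by
    refine hφ.continuousAt.eventually ?_
    rw [hzero.self_of_nhds]
    exact hV.eventually_analyticAt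
  obtain ⟨ε, hε, hball⟩ := Metric.eventually_nhds_iff_ball.1
    (heq.and (hφ.eventually_analyticAt.and hV'))
  filter_upwards [Metric.ball_mem_nhds ((0 : ℂ), x₀) hε] with y hy
  rw [← ball_prod_same] at hy
  have hmem : ∀ t ∈ Metric.ball (0 : ℂ) ε, (t, y.2) ∈ Metric.ball ((0 : ℂ), x₀) ε := by
    intro t ht
    rw [← ball_prod_same]
    exact ⟨ht, hy.2⟩
  have hdiff : DifferentiableOn ℂ (fun t => V (φ (t, y.2))) (Metric.ball 0 ε) := by
    intro t ht
    obtain ⟨-, h1, h2⟩ := hball _ (hmem t ht)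
    have h3 : DifferentiableAt ℂ (fun t : ℂ => (t, y.2)) t := by fun_prop
    exact (h2.differentiableAt.comp t (h1.differentiableAt.comp t h3)).differentiableWithinAt
  -- The equation only involves integrals along radii. A holomorphic primitive on the disc evaluates
  -- them, and differentiating it gives the complex time derivative.
  obtain ⟨P, hP⟩ := hdiff.isExactOn_ball
  have hφP : ∀ t ∈ Metric.ball (0 : ℂ) ε, φ (t, y.2) = y.2 + (P t - P 0) := by
    intro t ht
    have h1 := (hball _ (hmem t ht)).1
    rw [h1]
    congr 1
    dsimp only
    rw [unitInterval.integral_eq_intervalIntegral (fun u : ℝ => V (φ ((u : ℂ) * t, y.2)))]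
    have hut : ∀ u ∈ uIcc (0 : ℝ) 1, (u : ℂ) * t ∈ Metric.ball (0 : ℂ) ε := by
      intro u hu
      rw [uIcc_of_le zero_le_one] at hu
      rw [mem_ball_zero_iff] at ht ⊢
      rw [norm_mul, Complex.norm_real, Real.norm_eq_abs, abs_of_nonneg hu.1]
      exact lt_of_le_of_lt (mul_le_of_le_one_left (norm_nonneg _) hu.2) ht
    have hder : ∀ u ∈ uIcc (0 : ℝ) 1, HasDerivAt (fun u : ℝ => P ((u : ℂ) * t))
        (t • V (φ ((u : ℂ) * t, y.2))) u := by
      intro u hu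
      have h2 : HasDerivAt (fun u : ℝ => (u : ℂ) * t) t u := by
        simpa using (Complex.ofRealCLM.hasDerivAt (x := u)).mul_const t
      exact (hP _ (hut u hu)).scomp u h2
    have hcont : ContinuousOn (fun u : ℝ => t • V (φ ((u : ℂ) * t, y.2))) (uIcc 0 1) := by
      refine ContinuousOn.const_smul ?_ t
      exact hdiff.continuousOn.comp (by fun_prop) hut
    have h3 := intervalIntegral.integral_eq_sub_of_hasDerivAt hder hcont.intervalIntegrable
    rw [intervalIntegral.integral_smul] at h3
    simpa using h3
  have h4 : HasDerivAt (fun t => y.2 + (P t - P 0)) (V (φ y)) y.1 :=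
    ((hP y.1 hy.1).sub_const _).const_add _
  refine h4.congr_of_eventuallyEq ?_
  filter_upwards [Metric.isOpen_ball.mem_nhds hy.1] with t ht using hφP t ht

/-- A local analytic inverse: an analytic map with invertible derivative restricts to an analytic
isomorphism between open sets. -/
theorem AnalyticAt.exists_openPartialHomeomorph {E : Type*} [NormedAddCommGroup E]
    [NormedSpace ℂ E] [CompleteSpace E] {f : E → E} {x : E} (hf : AnalyticAt ℂ f x)
    {f' : E ≃L[ℂ] E} (hf' : HasFDerivAt f (f' : E →L[ℂ] E) x) {S : Set E} (hS : S ∈ 𝓝 x) :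
    ∃ ψ : OpenPartialHomeomorph E E, x ∈ ψ.source ∧ ψ.source ⊆ S ∧ (ψ : E → E) = f ∧
      ContDiffOn ℂ ω ψ ψ.source ∧ ContDiffOn ℂ ω ψ.symm ψ.target := by
  have hω : (ω : WithTop ℕ∞) ≠ 0 := by simp
  have hcd : ContDiffAt ℂ ω f x := hf.contDiffAt
  set Ψ := hcd.toOpenPartialHomeomorph f hf' hω
  have hsymm : AnalyticAt ℂ Ψ.symm (f x) := (hcd.to_localInverse hf' hω).analyticAt
  have hev : ∀ᶠ z in 𝓝 x, z ∈ S ∧ AnalyticAt ℂ f z ∧ AnalyticAt ℂ Ψ.symm (f z) :=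
    Filter.Eventually.and hS (hf.eventually_analyticAt.and
      (hf.continuousAt.eventually hsymm.eventually_analyticAt))
  obtain ⟨U, hU, hUo, hxU⟩ := eventually_nhds_iff.1 hev
  refine ⟨Ψ.restr U, ?_, ?_, rfl, ?_, ?_⟩
  · rw [Ψ.restr_source' _ hUo]
    exact ⟨hcd.mem_toOpenPartialHomeomorph_source hf' hω, hxU⟩
  · rw [Ψ.restr_source' _ hUo]
    exact fun z hz => (hU z hz.2).1
  · rw [Ψ.restr_source' _ hUo]
    exact fun z hz => ((hU z hz.2).2.1.contDiffAt).contDiffWithinAt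
  · intro w hw
    have h1 := (Ψ.restr U).map_target hw
    rw [Ψ.restr_source' _ hUo] at h1
    have h2 := (hU _ h1.2).2.2
    have h3 : f ((Ψ.restr U).symm w) = w := (Ψ.restr U).right_inv hw
    rw [h3] at h2
    exact h2.contDiffAt.contDiffWithinAt

variable {n : ℕ} [NeZero n]

/-- The complex-linear coordinate `z₁`. -/
noncomputable def firstCoord (n : ℕ) [NeZero n] : EuclideanSpace ℂ (Fin n) →L[ℂ] ℂ :=
  EuclideanSpace.proj (0 : Fin n)

/-- A nonvanishing analytic vector field on `ℂⁿ` is locally constant in suitable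
analytic coordinates. -/
theorem AnalyticAt.exists_flowBox {V : EuclideanSpace ℂ (Fin n) → EuclideanSpace ℂ (Fin n)}
    {x₀ : EuclideanSpace ℂ (Fin n)} (hV : AnalyticAt ℂ V x₀) (h0 : V x₀ ≠ 0)
    {S : Set (EuclideanSpace ℂ (Fin n))} (hS : S ∈ 𝓝 x₀) :
    ∃ ψ : OpenPartialHomeomorph (EuclideanSpace ℂ (Fin n)) (EuclideanSpace ℂ (Fin n)),
      x₀ ∈ ψ.source ∧ ψ.source ⊆ S ∧ IsBiholo n ψ ∧
      ∀ w ∈ ψ.target, HasFDerivAt ψ.symm (fderiv ℂ ψ.symm w) w ∧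
        fderiv ℂ ψ.symm w (horizontalUnit n) = V (ψ.symm w) := by
  obtain ⟨φ, hφ, hzero, hflow⟩ := hV.exists_flow
  obtain ⟨A, hA⟩ := SeparatingDual.exists_continuousLinearEquiv_apply_eq (R := ℂ)
    (horizontalUnit_ne_zero (n := n)) h0
  obtain ⟨B, hB⟩ : ∃ B : EuclideanSpace ℂ (Fin n) →L[ℂ] EuclideanSpace ℂ (Fin n),
      ∀ v, B v = A (v - firstCoord n v • horizontalUnit n) :=
    ⟨(A : EuclideanSpace ℂ (Fin n) →L[ℂ] EuclideanSpace ℂ (Fin n)).comp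
      (ContinuousLinearMap.id ℂ _ - (firstCoord n).smulRight (horizontalUnit n)), fun v => rfl⟩
  -- The box map `φ ∘ q` flows for complex time z₁ from a point of the slice `x₀ + B z`. The map `B`
  -- kills the horizontal unit, so moving z along that vector changes only the time.
  set q : EuclideanSpace ℂ (Fin n) → ℂ × EuclideanSpace ℂ (Fin n) := fun z =>
    (firstCoord n z, x₀ + B z) with hq
  have hq' : ∀ z, HasFDerivAt q ((firstCoord n).prod B) z := fun z =>
    (firstCoord n).hasFDerivAt.prodMk (B.hasFDerivAt.const_add x₀)
  have hqan : AnalyticAt ℂ q 0 :=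
    ((firstCoord n).analyticAt 0).prod (analyticAt_const.add (B.analyticAt 0))
  have hq0 : q 0 = (0, x₀) := by simp [hq]
  have hfirst : firstCoord n (horizontalUnit n) = 1 := by simp [firstCoord]
  set f : EuclideanSpace ℂ (Fin n) → EuclideanSpace ℂ (Fin n) := fun z => φ (q z) with hf
  have hφq : AnalyticAt ℂ φ (q 0) := by rw [hq0]; exact hφ
  have hfan : AnalyticAt ℂ f 0 := hφq.comp hqan
  have hf0 : f 0 = x₀ := by rw [hf]; dsimp only; rw [hq0]; exact hzero.self_of_nhds
  have hqt : Tendsto q (𝓝 0) (𝓝 (0, x₀)) := by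
    rw [← hq0]; exact hqan.continuousAt
  have hft : Tendsto f (𝓝 0) (𝓝 x₀) := by
    have := hfan.continuousAt.tendsto
    rwa [hf0] at this
  -- the time derivative of the flow
  have htime : ∀ y, DifferentiableAt ℂ φ y → HasDerivAt (fun t => φ (t, y.2)) (V (φ y)) y.1 →
      fderiv ℂ φ y (1, 0) = V (φ y) := by
    intro y hy hd
    have h1 : HasDerivAt (fun t : ℂ => (t, y.2)) ((1 : ℂ), (0 : EuclideanSpace ℂ (Fin n))) y.1 :=
      (hasDerivAt_id y.1).prodMk (hasDerivAt_const _ _)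
    have h2 : HasFDerivAt φ (fderiv ℂ φ y) (y.1, y.2) := hy.hasFDerivAt
    exact (h2.comp_hasDerivAt y.1 h1).unique hd
  have hspace : ∀ v, fderiv ℂ φ (0, x₀) (0, v) = v := by
    intro v
    have h1 : HasFDerivAt (fun x : EuclideanSpace ℂ (Fin n) => ((0 : ℂ), x))
        (ContinuousLinearMap.inr ℂ ℂ (EuclideanSpace ℂ (Fin n))) x₀ :=
      (ContinuousLinearMap.inr ℂ ℂ (EuclideanSpace ℂ (Fin n))).hasFDerivAt
    have h2 := HasFDerivAt.comp x₀ hφ.differentiableAt.hasFDerivAt h1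
    have h3 : HasFDerivAt (φ ∘ fun x : EuclideanSpace ℂ (Fin n) => ((0 : ℂ), x))
        (ContinuousLinearMap.id ℂ _) x₀ := (hasFDerivAt_id x₀).congr_of_eventuallyEq hzero
    exact congrArg (fun l : EuclideanSpace ℂ (Fin n) →L[ℂ] _ => l v) (h2.unique h3)
  -- The time direction contributes `V x₀`, the image of the horizontal unit under `A`, and the
  -- slice contributes `B`; together they give `A`.
  have hder : HasFDerivAt f (A : EuclideanSpace ℂ (Fin n) →L[ℂ] EuclideanSpace ℂ (Fin n)) 0 := by
    have h1 := HasFDerivAt.comp 0 hφq.differentiableAt.hasFDerivAt (hq' 0)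
    refine h1.congr_fderiv ?_
    ext1 v
    have h2 := htime _ hφ.differentiableAt hflow.self_of_nhds
    rw [hzero.self_of_nhds] at h2
    have h3 : ((firstCoord n v, B v) : ℂ × EuclideanSpace ℂ (Fin n)) =
        firstCoord n v • (1, 0) + (0, B v) := by simp
    rw [ContinuousLinearMap.comp_apply, ContinuousLinearMap.prod_apply, h3, hq0, map_add, map_smul,
      h2, hspace, hB, map_sub, map_smul, hA]
    change _ = A v
    abel
  have hgood : ∀ᶠ z in 𝓝 (0 : EuclideanSpace ℂ (Fin n)), f z ∈ S ∧ AnalyticAt ℂ φ (q z) ∧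
      HasDerivAt (fun t => φ (t, (q z).2)) (V (φ (q z))) (q z).1 :=
    (hft.eventually hS).and ((hqt.eventually hφ.eventually_analyticAt).and (hqt.eventually hflow))
  obtain ⟨ψ, hψ0, hψS, hψf, hψ1, hψ2⟩ := hfan.exists_openPartialHomeomorph hder hgood
  refine ⟨ψ.symm, ?_, fun y hy => ?_, ⟨?_, ?_⟩, fun w hw => ?_⟩
  · have := ψ.map_source hψ0
    rwa [hψf, hf0] at this
  · have := (hψS (ψ.map_target hy)).1
    rwa [← hψf, ψ.right_inv hy] at this
  · exact contMDiffOn_iff_contDiffOn.2 hψ2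
  · exact contMDiffOn_iff_contDiffOn.2 hψ1
  · obtain ⟨-, h1, h2⟩ := hψS hw
    rw [OpenPartialHomeomorph.symm_symm, hψf]
    have h3 := HasFDerivAt.comp w h1.differentiableAt.hasFDerivAt (hq' w)
    have h4 : HasFDerivAt f _ w := h3
    refine ⟨h4.differentiableAt.hasFDerivAt, ?_⟩
    rw [h4.fderiv]
    have h5 : (firstCoord n).prod B (horizontalUnit n) = (1, 0) := by
      rw [ContinuousLinearMap.prod_apply, hB, hfirst, one_smul, sub_self, map_zero]
    rw [ContinuousLinearMap.comp_apply, h5, htime _ h1.differentiableAt h2]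

end FlowBox

/-! ### Real and complex differentials of charts -/

section TangentMaps

variable {n : ℕ} {X : Type*} [TopologicalSpace X] [ChartedSpace (EuclideanSpace ℂ (Fin n)) X]

/-- The complex differential of a holomorphic map, seen as a real linear map, is its real
differential. -/
theorem mfderiv_realTangent {f : X → EuclideanSpace ℂ (Fin n)} {x : X}
    (hf : MDifferentiableAt 𝓘(ℂ, EuclideanSpace ℂ (Fin n)) 𝓘(ℂ, EuclideanSpace ℂ (Fin n)) f x)
    (w : TangentSpace 𝓘(ℂ, EuclideanSpace ℂ (Fin n)) x) :
    (mfderiv 𝓘(ℝ, EuclideanSpace ℂ (Fin n)) 𝓘(ℝ, EuclideanSpace ℂ (Fin n)) f x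
      (SmoothFoliation.realTangent w) : EuclideanSpace ℂ (Fin n)) =
    mfderiv 𝓘(ℂ, EuclideanSpace ℂ (Fin n)) 𝓘(ℂ, EuclideanSpace ℂ (Fin n)) f x w := by
  let g : EuclideanSpace ℂ (Fin n) →L[ℂ] EuclideanSpace ℂ (Fin n) :=
    mfderiv 𝓘(ℂ, EuclideanSpace ℂ (Fin n)) 𝓘(ℂ, EuclideanSpace ℂ (Fin n)) f x
  let g' : EuclideanSpace ℂ (Fin n) →L[ℝ] EuclideanSpace ℂ (Fin n) := g.restrictScalars ℝ
  have h : HasMFDerivAt 𝓘(ℂ, EuclideanSpace ℂ (Fin n)) 𝓘(ℂ, EuclideanSpace ℂ (Fin n)) f x g :=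
    hf.hasMFDerivAt
  have h' : HasMFDerivAt 𝓘(ℝ, EuclideanSpace ℂ (Fin n)) 𝓘(ℝ, EuclideanSpace ℂ (Fin n)) f x g' :=
    ⟨h.1, HasFDerivWithinAt.restrictScalars ℝ h.2⟩
  rw [h'.mfderiv]
  rfl

theorem IsRealDiffeo.mdifferentiable {f : OpenPartialHomeomorph X (EuclideanSpace ℂ (Fin n))}
    (hf : IsRealDiffeo n f) :
    f.MDifferentiable 𝓘(ℝ, EuclideanSpace ℂ (Fin n)) 𝓘(ℝ, EuclideanSpace ℂ (Fin n)) :=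
  ⟨hf.1.mdifferentiableOn (by simp), hf.2.mdifferentiableOn (by simp)⟩

theorem IsBiholo.mdifferentiable {M N : Type*} [TopologicalSpace M]
    [ChartedSpace (EuclideanSpace ℂ (Fin n)) M] [TopologicalSpace N]
    [ChartedSpace (EuclideanSpace ℂ (Fin n)) N] {f : OpenPartialHomeomorph M N}
    (hf : IsBiholo n f) :
    f.MDifferentiable 𝓘(ℂ, EuclideanSpace ℂ (Fin n)) 𝓘(ℂ, EuclideanSpace ℂ (Fin n)) :=
  ⟨hf.1.mdifferentiableOn (by simp), hf.2.mdifferentiableOn (by simp)⟩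

/-- The differential of a transition map between two real charts. -/
theorem fderiv_transition {f g : OpenPartialHomeomorph X (EuclideanSpace ℂ (Fin n))}
    (hf : IsRealDiffeo n f) (hg : IsRealDiffeo n g) {x : X} (hxf : x ∈ f.source)
    (hxg : x ∈ g.source) (w : TangentSpace 𝓘(ℝ, EuclideanSpace ℂ (Fin n)) x) :
    DifferentiableAt ℝ (fun z => g (f.symm z)) (f x) ∧
      fderiv ℝ (fun z => g (f.symm z)) (f x)
        (mfderiv 𝓘(ℝ, EuclideanSpace ℂ (Fin n)) 𝓘(ℝ, EuclideanSpace ℂ (Fin n)) f x w) =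
      mfderiv 𝓘(ℝ, EuclideanSpace ℂ (Fin n)) 𝓘(ℝ, EuclideanSpace ℂ (Fin n)) g x w := by
  have h1 := hf.mdifferentiable.mdifferentiableAt hxf
  have h2 := hf.mdifferentiable.mdifferentiableAt_symm (f.map_source hxf)
  have h3 : MDifferentiableAt 𝓘(ℝ, EuclideanSpace ℂ (Fin n)) 𝓘(ℝ, EuclideanSpace ℂ (Fin n)) g
      (f.symm (f x)) := by
    rw [f.left_inv hxf]; exact hg.mdifferentiable.mdifferentiableAt hxg
  have h4 : MDifferentiableAt 𝓘(ℝ, EuclideanSpace ℂ (Fin n)) 𝓘(ℝ, EuclideanSpace ℂ (Fin n))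
      (fun z => g (f.symm z)) (f x) := h3.comp (f x) h2
  refine ⟨h4.differentiableAt, ?_⟩
  have h5 := h4.hasMFDerivAt.comp x h1.hasMFDerivAt
  have h6 : g =ᶠ[𝓝 x] (fun z => g (f.symm z)) ∘ f := by
    filter_upwards [f.open_source.mem_nhds hxf] with y hy
    simp [f.left_inv hy]
  rw [(h5.congr_of_eventuallyEq h6).mfderiv, mfderiv_eq_fderiv]
  rfl

end TangentMaps

/-! ### Part (a): holomorphic charts versus holomorphic fields -/

namespace SmoothFoliation

variable {n : ℕ} [NeZero n] {X : Type*} [TopologicalSpace X]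
  [ChartedSpace (EuclideanSpace ℂ (Fin n)) X] {F : SmoothFoliation n X}

/-- Compatibility keeps the image of a short horizontal segment in a horizontal line, so its
velocity is horizontal. -/
theorem fderiv_transition_mem {e e' : OpenPartialHomeomorph X (EuclideanSpace ℂ (Fin n))}
    (he : e ∈ F.charts) (he' : e' ∈ F.charts) {x : X} (hx : x ∈ e.source) (hx' : x ∈ e'.source) :
    fderiv ℝ (fun z => e' (e.symm z)) (e x) (horizontalUnit n) ∈ horizontalLine n := by
  have h1 := (fderiv_transition (F.diffeo e he) (F.diffeo e' he') hx hx' 0).1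
  have h2 : HasDerivAt (fun s : ℝ => e x + s • horizontalUnit n) (horizontalUnit n) 0 := by
    simpa using ((hasDerivAt_id (0 : ℝ)).smul_const (horizontalUnit n)).const_add (e x)
  have h3 := h1.hasFDerivAt.comp_hasDerivAt_of_eq 0 h2 (by simp)
  refine h3.mem_horizontalLine ?_
  obtain ⟨O, hO, hOs, h⟩ := F.compatible e he e' he' x ⟨hx, hx'⟩
  have hsymm : Tendsto e.symm (𝓝 (e x)) (𝓝 x) := by
    simpa [ContinuousAt, e.left_inv hx] using e.continuousAt_symm (e.map_source hx)
  filter_upwards [(tendsto_add_smul_horizontalUnit (e x)).eventually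
    ((e.open_target.eventually_mem (e.map_source hx)).and (hsymm.eventually hO))] with s hs
  have h4 := (h _ hs.2 x (mem_of_mem_nhds hO)).1 (by
    rw [e.right_inv hs.1, add_sub_cancel_left]
    exact smul_horizontalUnit_mem s)
  simpa [e.left_inv hx] using h4

/-- The field is the pullback of the constant horizontal unit field by a holomorphic chart;
transitions carry its direction to every other chart. -/
theorem HasHolomorphicAtlas.isLocallyInduced [IsManifold 𝓘(ℂ, EuclideanSpace ℂ (Fin n)) ω X]
    (h : F.HasHolomorphicAtlas) : F.IsLocallyInducedByHolomorphicFields := by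
  intro p
  obtain ⟨A, hAF, hAb, hAc⟩ := h
  obtain ⟨e, heA, hp⟩ := hAc p
  have he := hAF heA
  have heb := hAb e heA
  let v := VectorField.mpullback 𝓘(ℂ, EuclideanSpace ℂ (Fin n)) 𝓘(ℂ, EuclideanSpace ℂ (Fin n)) e
    (fun _ => horizontalUnit n)
  have hinv : ∀ x ∈ e.source, (mfderiv 𝓘(ℂ, EuclideanSpace ℂ (Fin n))
      𝓘(ℂ, EuclideanSpace ℂ (Fin n)) e x).IsInvertible := fun x hx =>
    ⟨heb.mdifferentiable.mfderiv hx, rfl⟩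
  have hev : ∀ x ∈ e.source, mfderiv 𝓘(ℂ, EuclideanSpace ℂ (Fin n))
      𝓘(ℂ, EuclideanSpace ℂ (Fin n)) e x (v x) = horizontalUnit n := fun x hx =>
    (hinv x hx).self_apply_inverse (horizontalUnit n)
  refine ⟨e.source, e.open_source, hp, v, fun x hx => ?_, fun x hx => ⟨fun h0 => ?_, ?_⟩⟩
  · refine ContMDiffAt.contMDiffWithinAt ?_
    refine ContMDiffAt.mpullback_vectorField_preimage (n := ω) ?_
      (heb.1.contMDiffAt (e.open_source.mem_nhds hx)) (hinv x hx) le_top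
    exact contMDiffAt_vectorSpace_iff_contDiffAt.2 contDiffAt_const
  · have h1 := hev x hx
    rw [h0, map_zero] at h1
    exact horizontalUnit_ne_zero h1.symm
  · intro e' he' hx'
    rw [← (fderiv_transition (F.diffeo e he) (F.diffeo e' he') hx hx' _).2,
      mfderiv_realTangent (heb.mdifferentiable.mdifferentiableAt hx), hev x hx]
    exact fderiv_transition_mem he he' hx hx'

/-- A chart in which the vector field inducing a foliation is constant is a chart for the
foliation. -/
theorem mem_charts_of_isInducedOn {v : ∀ x : X, TangentSpace 𝓘(ℂ, EuclideanSpace ℂ (Fin n)) x}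
    {W : Set X} (hvW : F.IsInducedOn v W)
    {e : OpenPartialHomeomorph X (EuclideanSpace ℂ (Fin n))} (he : IsBiholo n e)
    (heW : e.source ⊆ W) (hev : ∀ x ∈ e.source, mfderiv 𝓘(ℂ, EuclideanSpace ℂ (Fin n))
      𝓘(ℂ, EuclideanSpace ℂ (Fin n)) e x (v x) = horizontalUnit n) : e ∈ F.charts := by
  refine F.maximal e he.isRealDiffeo fun e' he' p hp => ?_
  have hev' : ∀ x ∈ e.source, mfderiv 𝓘(ℝ, EuclideanSpace ℂ (Fin n))
      𝓘(ℝ, EuclideanSpace ℂ (Fin n)) e x (realTangent (v x)) = horizontalUnit n := fun x hx =>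
    (mfderiv_realTangent (he.mdifferentiable.mdifferentiableAt hx) _).trans (hev x hx)
  have h1 : ∀ x ∈ e.source, x ∈ e'.source →
      DifferentiableAt ℝ (fun z => e' (e.symm z)) (e x) ∧
      fderiv ℝ (fun z => e' (e.symm z)) (e x) (horizontalUnit n) ∈ horizontalLine n := by
    intro x hx hx'
    obtain ⟨h, h'⟩ := fderiv_transition he.isRealDiffeo (F.diffeo e' he') hx hx'
      (realTangent (v x))
    rw [hev' x hx] at h'
    exact ⟨h, h' ▸ (hvW x (heW hx)).2 e' he' hx'⟩
  have h2 : ∀ x ∈ e.source, x ∈ e'.source →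
      DifferentiableAt ℝ (fun z => e (e'.symm z)) (e' x) ∧
      fderiv ℝ (fun z => e (e'.symm z)) (e' x) (horizontalUnit n) ∈ horizontalLine n := by
    intro x hx hx'
    obtain ⟨h, h'⟩ := fderiv_transition (F.diffeo e' he') he.isRealDiffeo hx' hx
      (realTangent (v x))
    refine ⟨h, ?_⟩
    obtain ⟨s, hs⟩ := mem_horizontalLine_iff_exists.1 ((hvW x (heW hx)).2 e' he' hx')
    rw [hev' x hx, hs, map_smul] at h'
    -- The reverse transition sends `s • horizontalUnit n` to the horizontal unit, which is nonzero;
    -- dividing by `s` then shows that it preserves the horizontal direction.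
    have hs0 : s ≠ 0 := by
      rintro rfl
      rw [zero_smul] at h'
      exact horizontalUnit_ne_zero h'.symm
    have := Submodule.smul_mem_iff (horizontalLine n) hs0 (x := fderiv ℝ
      (fun z => e (e'.symm z)) (e' x) (horizontalUnit n))
    rw [← this, h']
    simpa using smul_horizontalUnit_mem (n := n) 1
  have hball : ∀ f g : OpenPartialHomeomorph X (EuclideanSpace ℂ (Fin n)), p ∈ f.source →
      p ∈ g.source → ∃ r > 0, ∀ z ∈ Metric.ball (f p) r, z ∈ f.target ∧ f.symm z ∈ g.source := by
    intro f g hf hg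
    have hsymm : Tendsto f.symm (𝓝 (f p)) (𝓝 p) := by
      simpa [ContinuousAt, f.left_inv hf] using f.continuousAt_symm (f.map_source hf)
    exact Metric.eventually_nhds_iff_ball.1 ((f.open_target.eventually_mem (f.map_source hf)).and
      (hsymm.eventually (g.open_source.mem_nhds hg)))
  have hmain : ∀ f g : OpenPartialHomeomorph X (EuclideanSpace ℂ (Fin n)), p ∈ f.source →
      p ∈ g.source → (∀ x ∈ f.source, x ∈ g.source →
        DifferentiableAt ℝ (fun z => g (f.symm z)) (f x) ∧
        fderiv ℝ (fun z => g (f.symm z)) (f x) (horizontalUnit n) ∈ horizontalLine n) →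
      ∀ᶠ O in (𝓝 p).smallSets, ∀ x ∈ O, ∀ y ∈ O, f x - f y ∈ horizontalLine n →
        g x - g y ∈ horizontalLine n := by
    intro f g hf hg hfg
    obtain ⟨r, hr, hrB⟩ := hball f g hf hg
    have hN : ∀ᶠ x in 𝓝 p, x ∈ f.source ∧ f x ∈ Metric.ball (f p) r :=
      (f.open_source.eventually_mem hf).and
        ((f.continuousAt hf).eventually (Metric.ball_mem_nhds _ hr))
    have hB : ∀ z ∈ Metric.ball (f p) r, DifferentiableAt ℝ (fun z => g (f.symm z)) z ∧
        fderiv ℝ (fun z => g (f.symm z)) z (horizontalUnit n) ∈ horizontalLine n := by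
      intro z hz
      have := hfg _ (f.map_target (hrB z hz).1) (hrB z hz).2
      rwa [f.right_inv (hrB z hz).1] at this
    refine (eventually_smallSets' fun s t hst ht x hx y hy => ht x (hst hx) y (hst hy)).2
      ⟨_, hN, fun x hx y hy hxy => ?_⟩
    have := sub_mem_horizontalLine_of_fderiv (convex_ball (f p) r) (fun z hz => (hB z hz).1)
      (fun z hz => (hB z hz).2) hx.2 hy.2 hxy
    simpa only [f.left_inv hx.1, f.left_inv hy.1] using this
  -- Each implication survives shrinking the neighbourhood, so both hold on a common one.
  have hO := (hmain e e' hp.1 hp.2 fun x hx hx' => h1 x hx hx').and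
    ((hmain e' e hp.2 hp.1 fun x hx hx' => h2 x hx' hx).and
      (eventually_smallSets_subset.2 (inter_mem (e.open_source.mem_nhds hp.1)
        (e'.open_source.mem_nhds hp.2))))
  obtain ⟨O, hOp, hO⟩ := (eventually_smallSets.1 hO)
  obtain ⟨ha, hb, hc⟩ := hO O Subset.rfl
  exact ⟨O, hOp, hc, fun x hx y hy => ⟨ha x hx y hy, hb x hx y hy⟩⟩

/-- Read the field in the manifold chart at `p` and compose with a flow box: in the composite chart
the field is the horizontal unit. -/
theorem IsLocallyInducedByHolomorphicFields.hasHolomorphicAtlas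
    [IsManifold 𝓘(ℂ, EuclideanSpace ℂ (Fin n)) ω X]
    (h : F.IsLocallyInducedByHolomorphicFields) : F.HasHolomorphicAtlas := by
  refine ⟨F.holoCharts, fun e he => he.1, fun e he => he.2, fun p => ?_⟩
  obtain ⟨W, hW, hpW, v, hv, hvW⟩ := h p
  set φ := chartAt (EuclideanSpace ℂ (Fin n)) p
  have hpφ : p ∈ φ.source := mem_chart_source _ p
  have hφb : IsBiholo n φ := ⟨contMDiffOn_chart, contMDiffOn_chart_symm⟩
  let V : EuclideanSpace ℂ (Fin n) → EuclideanSpace ℂ (Fin n) :=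
    VectorField.mpullback 𝓘(ℂ, EuclideanSpace ℂ (Fin n)) 𝓘(ℂ, EuclideanSpace ℂ (Fin n)) φ.symm v
  have hinv : ∀ z ∈ φ.target, (mfderiv 𝓘(ℂ, EuclideanSpace ℂ (Fin n))
      𝓘(ℂ, EuclideanSpace ℂ (Fin n)) φ.symm z).IsInvertible := fun z hz =>
    ⟨hφb.symm.mdifferentiable.mfderiv hz, rfl⟩
  have hVv : ∀ z ∈ φ.target, mfderiv 𝓘(ℂ, EuclideanSpace ℂ (Fin n))
      𝓘(ℂ, EuclideanSpace ℂ (Fin n)) φ.symm z (V z) = v (φ.symm z) := fun z hz =>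
    (hinv z hz).self_apply_inverse _
  have hφV : ∀ x ∈ φ.source, mfderiv 𝓘(ℂ, EuclideanSpace ℂ (Fin n))
      𝓘(ℂ, EuclideanSpace ℂ (Fin n)) φ x (v x) = V (φ x) := fun x hx => by
    have h1 := hVv (φ x) (φ.map_source hx)
    have h2 := hφb.mdifferentiable.comp_symm_deriv (φ.map_source hx)
    rw [φ.left_inv hx] at h1 h2
    rw [← h1]
    exact congrArg (fun l : EuclideanSpace ℂ (Fin n) →L[ℂ] EuclideanSpace ℂ (Fin n) =>
      l (V (φ x))) h2
  have hVan : AnalyticAt ℂ V (φ p) := by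
    refine ContDiffAt.analyticAt (contMDiffAt_vectorSpace_iff_contDiffAt.1 ?_)
    refine ContMDiffAt.mpullback_vectorField_preimage (n := ω) ?_
      (hφb.2.contMDiffAt (φ.open_target.mem_nhds (φ.map_source hpφ)))
      (hinv _ (φ.map_source hpφ)) le_top
    rw [φ.left_inv hpφ]
    exact hv.contMDiffAt (hW.mem_nhds hpW)
  have hV0 : V (φ p) ≠ 0 := by
    intro h0
    have h1 := hVv (φ p) (φ.map_source hpφ)
    rw [h0, φ.left_inv hpφ] at h1
    exact (hvW p hpW).1 (h1.symm.trans (map_zero _))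
  have hsymm : Tendsto φ.symm (𝓝 (φ p)) (𝓝 p) := by
    simpa [ContinuousAt, φ.left_inv hpφ] using φ.continuousAt_symm (φ.map_source hpφ)
  obtain ⟨ψ, hψp, hψS, hψb, hψ⟩ := hVan.exists_flowBox hV0 (hsymm.eventually (hW.mem_nhds hpW))
  have heb : IsBiholo n (φ.trans ψ) := hφb.trans hψb
  refine ⟨φ.trans ψ, ⟨mem_charts_of_isInducedOn hvW heb (fun x hx => ?_) fun x hx => ?_, heb⟩,
    hpφ, hψp⟩
  · have hx1 : x ∈ φ.source := hx.1
    have hx2 : φ.symm (φ x) ∈ W := hψS hx.2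
    rwa [φ.left_inv hx1] at hx2
  · have hx1 : x ∈ φ.source := hx.1
    have hx2 : φ x ∈ ψ.source := hx.2
    have h1 : HasMFDerivAt 𝓘(ℂ, EuclideanSpace ℂ (Fin n)) 𝓘(ℂ, EuclideanSpace ℂ (Fin n)) ψ (φ x)
        (mfderiv 𝓘(ℂ, EuclideanSpace ℂ (Fin n)) 𝓘(ℂ, EuclideanSpace ℂ (Fin n)) ψ (φ x)) :=
      (hψb.mdifferentiable.mdifferentiableAt hx2).hasMFDerivAt
    have h2 := h1.comp x (hφb.mdifferentiable.mdifferentiableAt hx1).hasMFDerivAt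
    have h3 : mfderiv 𝓘(ℂ, EuclideanSpace ℂ (Fin n)) 𝓘(ℂ, EuclideanSpace ℂ (Fin n)) (φ.trans ψ) x
        (v x) = mfderiv 𝓘(ℂ, EuclideanSpace ℂ (Fin n)) 𝓘(ℂ, EuclideanSpace ℂ (Fin n)) ψ (φ x)
          (mfderiv 𝓘(ℂ, EuclideanSpace ℂ (Fin n)) 𝓘(ℂ, EuclideanSpace ℂ (Fin n)) φ x (v x)) := by
      rw [OpenPartialHomeomorph.coe_trans, h2.mfderiv]
      rfl
    rw [h3, hφV x hx1]
    have h4 := (hψ _ (ψ.map_source hx2)).2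
    rw [ψ.left_inv hx2, ← mfderiv_eq_fderiv] at h4
    have h5 := hψb.mdifferentiable.comp_symm_deriv (ψ.map_source hx2)
    rw [ψ.left_inv hx2] at h5
    rw [← h4]
    exact congrArg (fun l : EuclideanSpace ℂ (Fin n) →L[ℂ] EuclideanSpace ℂ (Fin n) =>
      l (horizontalUnit n)) h5

end SmoothFoliation

theorem theorem3p2 {n : ℕ} [NeZero n] {X : Type*} [TopologicalSpace X] [T2Space X]
    [ChartedSpace (EuclideanSpace ℂ (Fin n)) X]
    [IsManifold 𝓘(ℂ, EuclideanSpace ℂ (Fin n)) ω X] (F : SmoothFoliation n X) :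
    (F.HasHolomorphicAtlas ↔ F.IsLocallyInducedByHolomorphicFields) ∧
    (F.HasNoCompactLeaves → F.HasHolomorphicAtlas → F.IsQuasiholomorphic) :=
  ⟨⟨fun h => h.isLocallyInduced, fun h => h.hasHolomorphicAtlas⟩,
    fun hnc h => .of_hasHolomorphicAtlas hnc h⟩
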